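/- Let $1/2<p<1$. For a unit vector $\mathbf n\in\mathbb R^3$ let $\rho_{\mathbf n}=p\,|\mathbf n\rangle\langle\mathbf n|+(1-p)\,|{-\mathbf n}\rangle\langle{-\mathbf n}|$, where $|\mathbf n\rangle$ is the qubit pure state with Bloch vector $\mathbf n$. A complete $N$-qubit ensemble consists of the states $\rho_{\mathbf n}^{\otimes N}$ with $\mathbf n$ distributed according to a Borel probability measure $\nu$ on the unit sphere $S^2$ that has full support (every nonempty open subset of $S^2$ has positive measure). A compression protocol consists of a finite-dimensional Hilbert space $\mathcal H_{\rm enc}$ and two quantum channels (completely positive trace preserving maps), the encoding $\mathcal E$ from the operators on $(\mathbb C^2)^{\otimes N}$ to the operators on $\mathcal H_{\rm enc}$ and the decoding $\mathcal D$ in the opposite direction; it encodes into $\log_2\dim\mathcal H_{\rm enc}$ qubits, and its error is $$e_N=\int_{S^2}\tfrac12\left\|\rho_{\mathbf n}^{\otimes N}-\mathcal D(\mathcal E(\rho_{\mathbf n}^{\otimes N}))\right\|_1\,d\nu(\mathbf n).$$ Suppose that $\mathcal H_{\rm enc}$ carries a continuous unitary representation $g\mapsto V_g$ of $SU(2)$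 such that 1. the encoding is covariant: $\mathcal E(U_g^{\otimes N}X\,U_g^{\otimes N\dagger})=V_g\,\mathcal E(X)\,V_g^\dagger$ for all $g\in SU(2)$ and all operators $X$, where $U_g$ is the defining representation; 2. the decoding preserves the magnitude of the total angular momentum: if $J^2=J_x^2+J_y^2+J_z^2$ and $K^2=K_x^2+K_y^2+K_z^2$ are formed from the generators of $g\mapsto U_g^{\otimes N}$ and of $g\mapsto V_g$ respectively, then for every state $\rho$ on $\mathcal H_{\rm enc}$ the distribution of $J^2$ in $\mathcal D(\rho)$ equals the distribution of $K^2$ in $\rho$, that is, $\operatorname{Tr}[\Pi_\lambda\,\mathcal D(\rho)]=\operatorname{Tr}[\widetilde\Pi_\lambda\,\rho]$ for every real $\lambda$, where $\Pi_\lambda$ and $\widetilde\Pi_\lambda$ are the orthogonal projectors on the $\lambda$-eigenspaces of $J^2$ and $K^2$. Then for every $\delta>0$ and every $\varepsilon>0$ there is $N_0$, depending only on $p$, $\delta$ and $\varepsilon$, such that for all $N\ge N_0$ every such protocol with $\log_2\dim\mathcal H_{\rm enc}\le(3/2-\delta)\log_2N$ has error $e_N\ge 1/2-\varepsilon$ on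 every complete $N$-qubit ensemble. -/

import Mathlib

open Matrix
open scoped ComplexOrder

noncomputable section

namespace QubitCompression

/-! ### Quantum states, channels and the trace norm -/

/-- A density matrix: positive semidefinite with trace one. -/
def IsState {m : Type*} [Fintype m] (ρ : Matrix m m ℂ) : Prop :=
  ρ.PosSemidef ∧ ρ.trace = 1

/-- The map `Φ ⊗ id` on matrices with an additional `k`-dimensional ancilla. -/
def ampliation {m n : Type*} (Φ : Matrix m m ℂ →ₗ[ℂ] Matrix n n ℂ) (k : ℕ)
    (X : Matrix (m × Fin k) (m × Fin k) ℂ) : Matrix (n × Fin k) (n × Fin k) ℂ :=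
  Matrix.of fun a b => Φ (Matrix.of fun i j => X (i, a.2) (j, b.2)) a.1 b.1

/-- A quantum channel: a linear, completely positive, trace preserving map. -/
structure IsChannel {m n : Type*} [Fintype m] [Fintype n]
    (Φ : Matrix m m ℂ →ₗ[ℂ] Matrix n n ℂ) : Prop where
  completelyPositive : ∀ (k : ℕ) (X : Matrix (m × Fin k) (m × Fin k) ℂ),
    X.PosSemidef → (ampliation Φ k X).PosSemidef
  tracePreserving : ∀ X : Matrix m m ℂ, (Φ X).trace = X.trace

/-- The trace norm: the sum of the singular values, i.e. of the square roots of the eigenvalues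
of `Aᴴ * A`. -/
def traceNorm {m : Type*} [Fintype m] [DecidableEq m] (A : Matrix m m ℂ) : ℝ :=
  ∑ i, Real.sqrt ((isHermitian_conjTranspose_mul_self A).eigenvalues i)

/-! ### Identically prepared mixed qubits -/

/-- The Pauli matrices `σ_x, σ_y, σ_z`. -/
def pauli : Fin 3 → Matrix (Fin 2) (Fin 2) ℂ :=
  ![!![0, 1; 1, 0], !![0, -Complex.I; Complex.I, 0], !![1, 0; 0, -1]]

/-- The projector `|n⟩⟨n|` on the qubit pure state with Bloch vector `n`. -/
def blochProj (n : EuclideanSpace ℝ (Fin 3)) : Matrix (Fin 2) (Fin 2) ℂ :=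
  (1 / 2 : ℂ) • (1 + ∑ a, (n a : ℂ) • pauli a)

/-- The mixed qubit state `ρ_n = p |n⟩⟨n| + (1 - p) |-n⟩⟨-n|`. -/
def qubitState (p : ℝ) (n : EuclideanSpace ℝ (Fin 3)) : Matrix (Fin 2) (Fin 2) ℂ :=
  (p : ℂ) • blochProj n + ((1 - p : ℝ) : ℂ) • blochProj (-n)

/-- The `N`-fold tensor power of a `2 × 2` matrix, acting on `N` qubits; the computational basis
of `N` qubits is indexed by `Fin N → Fin 2`. -/
def tensorPow (N : ℕ) (A : Matrix (Fin 2) (Fin 2) ℂ) :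
    Matrix (Fin N → Fin 2) (Fin N → Fin 2) ℂ :=
  Matrix.of fun x y => ∏ k, A (x k) (y k)

/-- The unit sphere of Bloch vectors. -/
abbrev BlochSphere : Type := Metric.sphere (0 : EuclideanSpace ℝ (Fin 3)) 1

/-- The average error of the protocol with encoding `E` and decoding `D` on the ensemble of the
states `ρ_n^{⊗N}`, with `n` distributed according to `ν`. -/
def averageError (p : ℝ) (N : ℕ) {d : ℕ} (ν : MeasureTheory.Measure BlochSphere)
    (E : Matrix (Fin N → Fin 2) (Fin N → Fin 2) ℂ →ₗ[ℂ] Matrix (Fin d) (Fin d) ℂ)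
    (D : Matrix (Fin d) (Fin d) ℂ →ₗ[ℂ] Matrix (Fin N → Fin 2) (Fin N → Fin 2) ℂ) : ℝ :=
  ∫ n : BlochSphere,
    traceNorm (tensorPow N (qubitState p n) - D (E (tensorPow N (qubitState p n)))) / 2 ∂ν

/-! ### Representations of `SU(2)` and angular momentum -/

/-- The group `SU(2)`. -/
abbrev SU2 : Type := Matrix.specialUnitaryGroup (Fin 2) ℂ

/-- The matrix `exp(-i θ σ_a / 2) = cos(θ/2) 1 - i sin(θ/2) σ_a`. -/
def rotMatrix (a : Fin 3) (θ : ℝ) : Matrix (Fin 2) (Fin 2) ℂ :=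
  (Real.cos (θ / 2) : ℂ) • (1 : Matrix (Fin 2) (Fin 2) ℂ)
    - (Complex.I * (Real.sin (θ / 2) : ℂ)) • pauli a

theorem rotMatrix_mem (a : Fin 3) (θ : ℝ) :
    rotMatrix a θ ∈ Matrix.specialUnitaryGroup (Fin 2) ℂ := by
  have h : (Real.cos (θ / 2) : ℂ) ^ 2 + (Real.sin (θ / 2) : ℂ) ^ 2 = 1 := by
    exact_mod_cast Real.cos_sq_add_sin_sq (θ / 2)
  rw [Matrix.mem_specialUnitaryGroup_iff, Matrix.mem_unitaryGroup_iff]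
  generalize hc : Real.cos (θ / 2) = c at h
  generalize hs : Real.sin (θ / 2) = s at h
  have hI := Complex.I_sq
  constructor
  · ext i j
    fin_cases a <;> fin_cases i <;> fin_cases j <;>
      simp [rotMatrix, pauli, Matrix.mul_apply, Matrix.star_apply, hc, hs, -Complex.ofReal_cos,
        -Complex.ofReal_sin] <;> grind
  · fin_cases a <;>
      simp [rotMatrix, pauli, Matrix.det_fin_two, hc, hs, -Complex.ofReal_cos,
        -Complex.ofReal_sin] <;> grind

/-- The one-parameter subgroup of rotations about the axis `a`. -/
def rot (a : Fin 3) (θ : ℝ) : SU2 := ⟨rotMatrix a θ, rotMatrix_mem a θ⟩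

/-- The generator of a matrix representation `W` of `SU(2)` for the rotations about the axis `a`,
i.e. the matrix `K_a` with `W (exp(-i θ σ_a / 2)) = exp(-i θ K_a)`, obtained by differentiating
at `θ = 0`. -/
def generator {m : Type*} (W : SU2 → Matrix m m ℂ) (a : Fin 3) : Matrix m m ℂ :=
  Matrix.of fun i j => Complex.I * deriv (fun θ : ℝ => W (rot a θ) i j) 0

/-- The square of the total angular momentum, `K² = K_x² + K_y² + K_z²`. -/
def angMomSq {m : Type*} [Fintype m] (W : SU2 → Matrix m m ℂ) : Matrix m m ℂ :=
  ∑ a, generator W a * generator W a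

/-- The orthogonal projector on the eigenspace of `H` with eigenvalue `l` (zero if `l` is not an
eigenvalue). -/
def eigenProj {m : Type*} [Fintype m] [DecidableEq m] (H : Matrix m m ℂ) (l : ℝ) :
    Matrix m m ℂ :=
  Matrix.toEuclideanLin.symm
    ((Module.End.eigenspace (Matrix.toEuclideanLin H) (l : ℂ)).starProjection :
      EuclideanSpace ℂ m →ₗ[ℂ] EuclideanSpace ℂ m)

/-- The tensor representation `g ↦ U_g^{⊗N}` of `SU(2)` on `N` qubits. -/
def qubitsRep (N : ℕ) (g : SU2) : Matrix (Fin N → Fin 2) (Fin N → Fin 2) ℂ :=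
  tensorPow N (g : Matrix (Fin 2) (Fin 2) ℂ)

/-- The encoding `E` is covariant: it intertwines conjugation by `U_g^{⊗N}` with conjugation
by `V_g`. -/
def IsCovariantEncoding {N d : ℕ} (V : SU2 →* Matrix.unitaryGroup (Fin d) ℂ)
    (E : Matrix (Fin N → Fin 2) (Fin N → Fin 2) ℂ →ₗ[ℂ] Matrix (Fin d) (Fin d) ℂ) : Prop :=
  ∀ (g : SU2) (X : Matrix (Fin N → Fin 2) (Fin N → Fin 2) ℂ),
    E (qubitsRep N g * X * (qubitsRep N g)ᴴ)
      = (V g : Matrix (Fin d) (Fin d) ℂ) * E X * (V g : Matrix (Fin d) (Fin d) ℂ)ᴴ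

/-- The decoding `D` preserves the magnitude of the total angular momentum: for every input state
`ρ`, the squared total angular momentum `J²` of the `N` qubits has the same distribution in `D ρ`
as the squared total angular momentum `K²` of the encoding system has in `ρ`. Every value `l` that
occurs is of the form `j (j + 1)`, and the projectors are those on the sectors with quantum
number `j`. -/
def PreservesAngMomMagnitude {N d : ℕ} (V : SU2 →* Matrix.unitaryGroup (Fin d) ℂ)
    (D : Matrix (Fin d) (Fin d) ℂ →ₗ[ℂ] Matrix (Fin N → Fin 2) (Fin N → Fin 2) ℂ) : Prop :=
  ∀ ρ : Matrix (Fin d) (Fin d) ℂ, IsState ρ → ∀ l : ℝ,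
    (eigenProj (angMomSq (qubitsRep N)) l * D ρ).trace
      = (eigenProj (angMomSq fun g => (V g : Matrix (Fin d) (Fin d) ℂ)) l * ρ).trace

end QubitCompression

end

namespace QubitCompression

/-! ### One-parameter groups and tangent curves -/

/-! A decoder that preserves the magnitude of the angular momentum outputs states supported on those
sectors of `J²` whose eigenvalue also occurs in the spectrum of `K²`. These are too few to hold the
input. A sector with quantum number j fills at least 2j + 1 dimensions of the encoding space, so at
most d/(2s) sectors with j(j + 1) ≥ s² occur there (`IsAngMom.card_mul_le`). For s a fixed fraction
of N and d ≤ N^(3/2 - δ) this is O(N^(1/2 - δ)) sectors. In the input state each sector has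
probability O(1/√N) (`sectorProb_le`), and all sectors below s, which is taken as half the typical
value (p - 1/2)N, have total probability O(1/N) by Chebyshev (`sum_sectorProb_small_le`). The
projector on the reachable sectors therefore has expectation 1 on the output and O(N^(-δ) + 1/N) on
the input. This bounds the trace distance from below for every Bloch vector (`le_error`), hence also
on average.

Representation theory enters only through weight multiplicities, the traces of products of a `J²`
projector with a `J_z` projector. Cyclicity of the trace, applied to the ladder operators, makes the
multiplicity constant along a string -j, …, j (`IsAngMom.weightMult_succ`, `weight_string`). This
yields both the dimension count and the sector probabilities: along the z axis the input is a
function of `J_z`, the multiplicity on a string is at most the binomial coefficient at its top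
weight, and lower weights contribute a geometric series of ratio (1 - p)/p, so a sector is no
likelier than a constant times one binomial probability.

Since the representation on the encoding space is only assumed continuous, its differentiability and
the commutation relations of its generators are derived first. -/

theorem norm_pow_sub_pow_le_mul {B : Type*} [NormedRing B] (x y : B) (hx : ‖x‖ ≤ 1)
    (hy : ‖y‖ ≤ 1) (k : ℕ) :
    ‖x ^ k - y ^ k‖ ≤ k * ‖x - y‖ := by
  induction k with
  | zero => simp
  | succ k ih =>
    rcases Nat.eq_zero_or_pos k with rfl | hk
    · simp
    have h1 : x ^ (k + 1) - y ^ (k + 1) = x ^ k * (x - y) + (x ^ k - y ^ k) * y := by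
      rw [pow_succ, pow_succ]; noncomm_ring
    have h2 : ‖x ^ k‖ ≤ 1 := (norm_pow_le' x hk).trans (pow_le_one₀ (norm_nonneg _) hx)
    calc ‖x ^ (k + 1) - y ^ (k + 1)‖ ≤ ‖x ^ k‖ * ‖x - y‖ + ‖x ^ k - y ^ k‖ * ‖y‖ := by
          rw [h1]; exact (norm_add_le _ _).trans (add_le_add (norm_mul_le _ _) (norm_mul_le _ _))
      _ ≤ 1 * ‖x - y‖ + (k * ‖x - y‖) * 1 := by gcongr
      _ = ((k + 1 : ℕ) : ℝ) * ‖x - y‖ := by push_cast; ring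

section OneParameter

variable {B : Type*} [NormedRing B] [NormedAlgebra ℝ B] [CompleteSpace B]

/-- Continuity upgrades to differentiability by averaging: U(t) ∫₀ʰ U = ∫ₜᵗ⁺ʰ U is differentiable in
t, and ∫₀ʰ U is invertible for small h because its quotient by h tends to 1. -/
theorem exists_hasDerivAt_of_oneParameter (U : ℝ → B) (hU : Continuous U)
    (h0 : U 0 = 1) (hadd : ∀ s t, U (s + t) = U s * U t) : ∃ A, HasDerivAt U A 0 := by
  set F : ℝ → B := fun x => ∫ s in (0 : ℝ)..x, U s with hF
  have hFd : ∀ x, HasDerivAt F (U x) x := fun x =>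
    intervalIntegral.integral_hasDerivAt_right (hU.intervalIntegrable _ _)
      hU.aestronglyMeasurable.stronglyMeasurableAtFilter hU.continuousAt
  have hF0 : F 0 = 0 := by simp [hF]
  obtain ⟨h, hh0, hunit⟩ : ∃ h : ℝ, h ≠ 0 ∧ IsUnit (F h) := by
    have hlim := (hFd 0).tendsto_slope_zero
    rw [h0] at hlim
    have hev := hlim.eventually (Units.isOpen.mem_nhds (isUnit_one (M := B)))
    obtain ⟨h, hne, hu⟩ := (hev.and self_mem_nhdsWithin).exists
    refine ⟨h, hu, ?_⟩
    simp only [zero_add, hF0, sub_zero] at hne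
    have hne' : IsUnit (h⁻¹ • F h) := hne
    have := (isUnit_smul_iff (Units.mk0 h⁻¹ (inv_ne_zero hu)) (F h)).1 (by
      simpa [Units.smul_def] using hne')
    exact this
  obtain ⟨u, hu⟩ := hunit
  have key : ∀ t, U t = (F (t + h) - F t) * ((u⁻¹ : Bˣ) : B) := by
    intro t
    have h1 : U t * F h = F (t + h) - F t := by
      have : U t * F h = ∫ s in (0 : ℝ)..h, U (t + s) := by
        simp only [hadd, hF]
        exact ((ContinuousLinearMap.mul ℝ B (U t)).intervalIntegral_comp_comm
          (hU.intervalIntegrable _ _)).symm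
      rw [this, intervalIntegral.integral_comp_add_left (fun s => U s) t, add_zero]
      simp only [hF]
      rw [intervalIntegral.integral_interval_sub_left (hU.intervalIntegrable _ _)
        (hU.intervalIntegrable _ _)]
    rw [← h1, ← hu, mul_assoc, Units.mul_inv, mul_one]
  refine ⟨(U (0 + h) - U 0) * ((u⁻¹ : Bˣ) : B), ?_⟩
  have h2 : HasDerivAt (fun t => F (t + h)) (U (0 + h)) 0 :=
    (hFd (0 + h)).comp_add_const 0 h
  have h3 := (h2.sub (hFd 0)).mul_const ((u⁻¹ : Bˣ) : B)
  exact h3.congr_of_eventuallyEq (Filter.Eventually.of_forall fun t => key t)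

theorem exp_add_smul (A : B) (s t : ℝ) :
    NormedSpace.exp ((s + t) • A) = NormedSpace.exp (s • A) * NormedSpace.exp (t • A) := by
  let _ : NormedAlgebra ℚ B := NormedAlgebra.restrictScalars ℚ ℝ B
  rw [add_smul, NormedSpace.exp_add_of_commute]
  exact ((Commute.refl A).smul_left s).smul_right t

/-- U(s) exp(-sA) has derivative zero, so it keeps its value 1 at s = 0. -/
theorem oneParameter_eq_exp (U : ℝ → B) (h0 : U 0 = 1) (hadd : ∀ s t, U (s + t) = U s * U t)
    {A : B} (hA : HasDerivAt U A 0) (t : ℝ) : U t = NormedSpace.exp (t • A) := by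
  have hd : ∀ t, HasDerivAt U (U t * A) t := by
    intro t
    have h1 : HasDerivAt (fun s => U t * U (s - t)) (U t * A) t := by
      have h2 : HasDerivAt (fun s => U (s - t)) A t := by
        have : HasDerivAt U A (t - t) := by simpa using hA
        exact this.comp_sub_const t t
      exact h2.const_mul _
    exact h1.congr_of_eventuallyEq (Filter.Eventually.of_forall fun s => by
      simp [← hadd])
  have he : ∀ t, HasDerivAt (fun s => U s * NormedSpace.exp (s • (-A))) 0 t := by
    intro t
    have := (hd t).mul (hasDerivAt_exp_smul_const' (𝕂 := ℝ) (-A) t)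
    convert! this using 1
    simp [mul_assoc]
  have hconst := is_const_of_deriv_eq_zero (fun t => (he t).differentiableAt)
    (fun t => (he t).deriv) t 0
  simp only [zero_smul, NormedSpace.exp_zero, mul_one, h0] at hconst
  have hinv : NormedSpace.exp (t • (-A)) * NormedSpace.exp (t • A) = 1 := by
    rw [smul_neg, ← neg_smul, ← exp_add_smul, neg_add_cancel, zero_smul, NormedSpace.exp_zero]
  calc U t = U t * (NormedSpace.exp (t • (-A)) * NormedSpace.exp (t • A)) := by rw [hinv, mul_one]
    _ = NormedSpace.exp (t • A) := by rw [← mul_assoc, hconst, one_mul]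

omit [CompleteSpace B] in
/-- Powers of a curve tangent to a one-parameter group converge to that group. -/
theorem tendsto_pow_of_hasDerivAt (c U : ℝ → B) (hc : ∀ s, ‖c s‖ ≤ 1)
    (hU : ∀ s, ‖U s‖ ≤ 1) (hc0 : c 0 = 1) (h0 : U 0 = 1)
    (hadd : ∀ s t, U (s + t) = U s * U t) {A : B} (hcA : HasDerivAt c A 0)
    (hUA : HasDerivAt U A 0) (t : ℝ) :
    Filter.Tendsto (fun k : ℕ => c (t / k) ^ k) Filter.atTop (nhds (U t)) := by
  have hUk : ∀ (k : ℕ) s, U s ^ k = U (k * s) := by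
    intro k s
    induction k with
    | zero => simp [h0]
    | succ k ih => rw [pow_succ, ih, ← hadd]; push_cast; ring_nf
  -- Equal tangents give c(t/k) - U(t/k) = o(1/k), and passing to k-th powers of contractions costs
  -- only a factor k.
  have hd : HasDerivAt (fun s => c s - U s) 0 0 := by
    have h := hcA.sub hUA
    rw [sub_self] at h
    exact h
  have ht : Filter.Tendsto (fun k : ℕ => t / (k : ℝ)) Filter.atTop (nhds 0) :=
    tendsto_const_div_atTop_nhds_zero_nat t
  have ho := (hasDerivAt_iff_isLittleO.1 hd).comp_tendsto ht
  simp only [Function.comp_def, hc0, h0, sub_self, sub_zero, smul_zero] at ho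
  rw [tendsto_iff_norm_sub_tendsto_zero, Metric.tendsto_atTop]
  intro ε hε
  have hb := ho.def (c := ε / (|t| + 1)) (by positivity)
  obtain ⟨K, hK⟩ := Filter.eventually_atTop.1 hb
  refine ⟨K + 1, fun k hk => ?_⟩
  have hk0 : (0 : ℝ) < k := by exact_mod_cast (by omega : 0 < k)
  have h1 := hK k (by omega)
  have h2 : U t = U (t / k) ^ k := by rw [hUk]; congr 1; field_simp
  rw [Real.dist_eq, sub_zero, abs_of_nonneg (norm_nonneg _), h2]
  refine (norm_pow_sub_pow_le_mul _ _ (hc _) (hU _) k).trans_lt ?_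
  calc (k : ℝ) * ‖c (t / k) - U (t / k)‖ ≤ k * (ε / (|t| + 1) * ‖t / (k : ℝ)‖) := by gcongr
    _ = ε * (|t| / (|t| + 1)) := by
        rw [Real.norm_eq_abs, abs_div, abs_of_pos hk0]; field_simp
    _ < ε * 1 := by
        gcongr
        rw [div_lt_one (by positivity)]; linarith
    _ = ε := mul_one ε

end OneParameter

/-! ### Infinitesimal generators of unitary representations of `SU(2)` -/

section Generators

open scoped Matrix.Norms.L2Operator

theorem pauli_mul_self (a : Fin 3) : pauli a * pauli a = 1 := by
  ext i j
  fin_cases a <;> fin_cases i <;> fin_cases j <;> simp [pauli, Matrix.mul_apply]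

theorem rot_zero (a : Fin 3) : rot a 0 = 1 := by
  apply Subtype.ext
  simp [rot, rotMatrix]

theorem rot_add (a : Fin 3) (s t : ℝ) : rot a (s + t) = rot a s * rot a t := by
  apply Subtype.ext
  change rotMatrix a (s + t) = rotMatrix a s * rotMatrix a t
  simp only [rotMatrix, add_div, Real.cos_add, Real.sin_add]
  simp only [sub_mul, mul_sub, Matrix.smul_mul, Matrix.mul_smul, pauli_mul_self, one_mul, mul_one,
    smul_smul]
  push_cast
  have hI : Complex.I * Complex.I = -1 := Complex.I_mul_I
  ext i j
  simp only [Matrix.sub_apply, Matrix.smul_apply, smul_eq_mul]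
  linear_combination
    (-Complex.sin (s / 2) * Complex.sin (t / 2) * (1 : Matrix (Fin 2) (Fin 2) ℂ) i j) * hI

theorem rot_neg (a : Fin 3) (t : ℝ) : rot a (-t) = (rot a t)⁻¹ := by
  rw [eq_inv_iff_mul_eq_one, ← rot_add, neg_add_cancel, rot_zero]

theorem hasDerivAt_rotMatrix (a : Fin 3) :
    HasDerivAt (rotMatrix a) (-(Complex.I / 2) • pauli a) 0 := by
  have h1 : HasDerivAt (fun θ : ℝ => θ / 2) (1 / 2) 0 := (hasDerivAt_id (0 : ℝ)).div_const 2
  have hc : HasDerivAt (fun θ : ℝ => ((Real.cos (θ / 2) : ℝ) : ℂ)) 0 0 := by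
    have := (h1.cos).ofReal_comp
    simpa using this
  have hs : HasDerivAt (fun θ : ℝ => ((Real.sin (θ / 2) : ℝ) : ℂ)) (1 / 2) 0 := by
    have := (h1.sin).ofReal_comp
    simpa using this
  have h := (hc.smul_const (1 : Matrix (Fin 2) (Fin 2) ℂ)).sub
    ((hs.const_mul Complex.I).smul_const (pauli a))
  convert! h using 1
  rw [zero_smul, zero_sub, ← neg_smul]
  congr 1
  ring

theorem continuous_rot (a : Fin 3) : Continuous (rot a) := by
  refine Continuous.subtype_mk ?_ _
  unfold rotMatrix
  fun_prop

theorem norm_coe_unitary_le {m : Type*} [Fintype m] [DecidableEq m]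
    (u : Matrix.unitaryGroup m ℂ) : ‖(u : Matrix m m ℂ)‖ ≤ 1 := by
  rcases subsingleton_or_nontrivial (Matrix m m ℂ) with h | h
  · rw [Subsingleton.elim (u : Matrix m m ℂ) 0, norm_zero]; exact zero_le_one
  · exact (CStarRing.norm_of_mem_unitary u.2).le

variable {m : Type*} [Fintype m] [DecidableEq m] (W : SU2 →* Matrix.unitaryGroup m ℂ)

theorem exists_hasDerivAt_rep (hW : Continuous W) (r : ℝ → SU2) (hr : Continuous r)
    (h0 : r 0 = 1) (hadd : ∀ s t, r (s + t) = r s * r t) :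
    ∃ A, HasDerivAt (fun s => (W (r s) : Matrix m m ℂ)) A 0 := by
  refine exists_hasDerivAt_of_oneParameter _ ?_ ?_ ?_
  · exact continuous_subtype_val.comp (hW.comp hr)
  · simp [h0]
  · intro s t
    simp [hadd]

/-- `generator` is built from entrywise `deriv`, which would silently be 0 without
differentiability; continuity of the representation makes it the true derivative. -/
theorem hasDerivAt_generator (hW : Continuous W) (a : Fin 3) :
    HasDerivAt (fun θ => (W (rot a θ) : Matrix m m ℂ))
      (-Complex.I • generator (fun g => (W g : Matrix m m ℂ)) a) 0 := by
  obtain ⟨A, hA⟩ := exists_hasDerivAt_rep W hW (rot a) (continuous_rot a) (rot_zero a) (rot_add a)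
  have hgen : generator (fun g => (W g : Matrix m m ℂ)) a = Complex.I • A := by
    ext i j
    have hij : HasDerivAt (fun θ => (W (rot a θ) : Matrix m m ℂ) i j) (A i j) 0 := by
      have := (LinearMap.toContinuousLinearMap
        (Matrix.entryLinearMap ℝ ℂ i j : Matrix m m ℂ →ₗ[ℝ] ℂ)).hasFDerivAt.comp_hasDerivAt 0 hA
      exact this
    simp [generator, hij.deriv]
  rw [hgen, smul_smul]
  simpa using hA

theorem rep_rot_eq_exp (hW : Continuous W) (a : Fin 3) (t : ℝ) :
    (W (rot a t) : Matrix m m ℂ) = NormedSpace.exp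
      (t • (-Complex.I • generator (fun g => (W g : Matrix m m ℂ)) a)) :=
  oneParameter_eq_exp (fun t => (W (rot a t) : Matrix m m ℂ)) (by simp [rot_zero])
    (by intro s t; simp [rot_add]) (hasDerivAt_generator W hW a) t

theorem isHermitian_generator (hW : Continuous W) (a : Fin 3) :
    (generator (fun g => (W g : Matrix m m ℂ)) a).IsHermitian := by
  have h := hasDerivAt_generator W hW a
  have h1 := h.star
  have h2 : HasDerivAt (fun θ => (W (rot a (-θ)) : Matrix m m ℂ))
      (-(-Complex.I • generator (fun g => (W g : Matrix m m ℂ)) a)) 0 := by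
    have h' : HasDerivAt (fun θ => (W (rot a θ) : Matrix m m ℂ))
      (-Complex.I • generator (fun g => (W g : Matrix m m ℂ)) a) (-0) := by simpa using h
    have := h'.scomp (0 : ℝ) (hasDerivAt_neg (0 : ℝ))
    simpa [Function.comp_def] using this
  have h3 : (fun θ => (W (rot a (-θ)) : Matrix m m ℂ))
      = fun θ => star (W (rot a θ) : Matrix m m ℂ) := by
    funext θ
    rw [rot_neg, map_inv]
    rfl
  rw [h3] at h2
  have h4 := h1.unique h2
  rw [star_smul, Matrix.star_eq_conjTranspose, neg_smul, neg_neg] at h4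
  have h5 : star (-Complex.I) = Complex.I := by simp
  rw [h5] at h4
  exact smul_right_injective _ Complex.I_ne_zero h4

theorem star_eq_neg_of_tangent (u : ℝ → Matrix.unitaryGroup m ℂ)
    (h0 : u 0 = 1) {A : Matrix m m ℂ} (hA : HasDerivAt (fun s => (u s : Matrix m m ℂ)) A 0) :
    star A = -A := by
  have h1 := hA.mul hA.star
  have h2 : (fun s => (u s : Matrix m m ℂ)) * (fun s => star (u s : Matrix m m ℂ))
      = fun _ => 1 := by
    funext s
    exact Unitary.mul_star_self_of_mem (u s).2
  rw [h2] at h1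
  have h3 := h1.unique (hasDerivAt_const 0 1)
  rw [h0, OneMemClass.coe_one, star_one, mul_one, one_mul] at h3
  exact eq_neg_of_add_eq_zero_right h3

/-- The tangent is skew-adjoint, so its exponentials are unitary. This is the contraction bound that
`tendsto_pow_of_hasDerivAt` asks of the limiting group. -/
theorem norm_exp_smul_le_of_tangent (u : ℝ → Matrix.unitaryGroup m ℂ)
    (h0 : u 0 = 1) {A : Matrix m m ℂ} (hA : HasDerivAt (fun s => (u s : Matrix m m ℂ)) A 0)
    (s : ℝ) : ‖NormedSpace.exp (s • A)‖ ≤ 1 := by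
  let _ : NormedAlgebra ℚ (Matrix m m ℂ) := NormedAlgebra.restrictScalars ℚ ℝ _
  have h : NormedSpace.exp (s • A) ∈ unitary (Matrix m m ℂ) :=
    NormedSpace.exp_mem_unitary_of_mem_skewAdjoint
      (skewAdjoint.mem_iff.2 (by
        rw [star_smul, star_eq_neg_of_tangent u h0 hA, smul_neg, star_trivial]))
  exact norm_coe_unitary_le ⟨_, h⟩

/-- The derivative at `0` of the image of a curve in `SU(2)` only depends on its tangent vector. -/
theorem hasDerivAt_rep_of_tangent (hW : Continuous W) (c r : ℝ → SU2)
    (h0 : r 0 = 1) (hadd : ∀ s t, r (s + t) = r s * r t) (hc0 : c 0 = 1)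
    {X : Matrix (Fin 2) (Fin 2) ℂ}
    (hc : HasDerivAt (fun s => (c s : Matrix (Fin 2) (Fin 2) ℂ)) X 0)
    (hrX : HasDerivAt (fun s => (r s : Matrix (Fin 2) (Fin 2) ℂ)) X 0) {A : Matrix m m ℂ}
    (hA : HasDerivAt (fun s => (W (c s) : Matrix m m ℂ)) A 0) :
    HasDerivAt (fun s => (W (r s) : Matrix m m ℂ)) A 0 := by
  have hnorm : ∀ g : SU2, ‖(g : Matrix (Fin 2) (Fin 2) ℂ)‖ ≤ 1 := fun g =>
    norm_coe_unitary_le ⟨g.1, (Matrix.mem_specialUnitaryGroup_iff.1 g.2).1⟩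
  have hlim : ∀ t : ℝ, Filter.Tendsto (fun k : ℕ => c (t / k) ^ k) Filter.atTop (nhds (r t)) := by
    intro t
    rw [tendsto_subtype_rng]
    exact tendsto_pow_of_hasDerivAt (fun s => (c s : Matrix (Fin 2) (Fin 2) ℂ))
      (fun s => (r s : Matrix (Fin 2) (Fin 2) ℂ)) (fun s => hnorm _) (fun s => hnorm _)
      (by simp [hc0]) (by simp [h0]) (by intro s t; simp [hadd]) hc hrX t
  have hexpd : HasDerivAt (fun s : ℝ => NormedSpace.exp (s • A)) A 0 := by
    simpa using hasDerivAt_exp_smul_const (𝕂 := ℝ) A (0 : ℝ)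
  -- The powers c(t/k)^k tend to r(t) in SU(2), while their images tend to exp(tA); continuity of
  -- `W` identifies the two limits.
  have hlimA : ∀ t : ℝ, (W (r t) : Matrix m m ℂ) = NormedSpace.exp (t • A) := by
    intro t
    have h1 := tendsto_pow_of_hasDerivAt (fun s => (W (c s) : Matrix m m ℂ))
      (fun s : ℝ => NormedSpace.exp (s • A)) (fun s => norm_coe_unitary_le _)
      (norm_exp_smul_le_of_tangent (fun s => W (c s)) (by rw [hc0, map_one]) hA)
      (by simp [hc0]) (by simp) (exp_add_smul A) hA hexpd t
    have h2 : Filter.Tendsto (fun k : ℕ => (W (c (t / k) ^ k) : Matrix m m ℂ)) Filter.atTop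
        (nhds (W (r t) : Matrix m m ℂ)) :=
      ((continuous_subtype_val.comp hW).tendsto (r t)).comp (hlim t)
    simp only [map_pow, SubmonoidClass.coe_pow] at h2
    exact tendsto_nhds_unique h2 h1
  rw [funext hlimA]
  exact hexpd

/-- Axes are added modulo 3, so one formula covers the three cyclic cases. -/
theorem rot_conj_tangent (a : Fin 3) (θ : ℝ) :
    rotMatrix (a + 2) θ * pauli a * rotMatrix (a + 2) (-θ)
      = (Real.cos θ : ℂ) • pauli a + (Real.sin θ : ℂ) • pauli (a + 1) := by
  have h1 : (Real.cos θ : ℂ) = (Real.cos (θ / 2) : ℂ) ^ 2 - (Real.sin (θ / 2) : ℂ) ^ 2 := by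
    have h2 := Real.cos_two_mul (θ / 2)
    rw [show 2 * (θ / 2) = θ by ring] at h2
    have h3 : Real.cos θ = Real.cos (θ / 2) ^ 2 - Real.sin (θ / 2) ^ 2 := by
      linarith [Real.cos_sq' (θ / 2)]
    rw [h3]; push_cast; rfl
  have h2 : (Real.sin θ : ℂ) = 2 * (Real.sin (θ / 2) : ℂ) * (Real.cos (θ / 2) : ℂ) := by
    have h2 := Real.sin_two_mul (θ / 2)
    rw [show 2 * (θ / 2) = θ by ring] at h2
    rw [h2]; push_cast; rfl
  have hc : Real.cos (-θ / 2) = Real.cos (θ / 2) := by rw [neg_div, Real.cos_neg]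
  have hs : Real.sin (-θ / 2) = -Real.sin (θ / 2) := by rw [neg_div, Real.sin_neg]
  unfold rotMatrix
  rw [h1, h2, hc, hs]
  generalize Real.cos (θ / 2) = c
  generalize Real.sin (θ / 2) = s
  have hI := Complex.I_sq
  ext i j
  fin_cases a <;> fin_cases i <;> fin_cases j <;>
    simp [pauli, Matrix.mul_apply] <;> grind

/-- The conjugated rotation subgroup and a product of two rotations about the axes a and a + 1 have
the same tangent in SU(2), so their images under `W` have the same derivative. -/
theorem rep_conj_generator (hW : Continuous W) (a : Fin 3) (θ : ℝ) :
    (W (rot (a + 2) θ) : Matrix m m ℂ) * generator (fun g => (W g : Matrix m m ℂ)) a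
        * (W (rot (a + 2) (-θ)) : Matrix m m ℂ)
      = (Real.cos θ : ℂ) • generator (fun g => (W g : Matrix m m ℂ)) a
        + (Real.sin θ : ℂ) • generator (fun g => (W g : Matrix m m ℂ)) (a + 1) := by
  set r : ℝ → SU2 := fun s => rot (a + 2) θ * rot a s * rot (a + 2) (-θ) with hr
  set c : ℝ → SU2 := fun s => rot a (Real.cos θ * s) * rot (a + 1) (Real.sin θ * s) with hc
  have hmul : ∀ k : ℝ, HasDerivAt (fun s : ℝ => k * s) k 0 := fun k => by
    simpa using (hasDerivAt_id (0 : ℝ)).const_mul k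
  have hscaleW : ∀ (k : ℝ) (a : Fin 3), HasDerivAt
      (fun s => (W (rot a (k * s)) : Matrix m m ℂ))
      (k • (-Complex.I • generator (fun g => (W g : Matrix m m ℂ)) a)) 0 := fun k a =>
    HasDerivAt.scomp (h := fun s : ℝ => k * s)
      (g₁ := fun θ => (W (rot a θ) : Matrix m m ℂ)) (0 : ℝ)
      (by rw [mul_zero]; exact hasDerivAt_generator W hW a) (hmul k)
  have hscaleR : ∀ (k : ℝ) (a : Fin 3), HasDerivAt (fun s => rotMatrix a (k * s))
      (k • (-(Complex.I / 2) • pauli a)) 0 := fun k a =>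
    HasDerivAt.scomp (h := fun s : ℝ => k * s)
      (g₁ := rotMatrix a) (0 : ℝ)
      (by rw [mul_zero]; exact hasDerivAt_rotMatrix a) (hmul k)
  have hcd : HasDerivAt (fun s => (W (c s) : Matrix m m ℂ))
      (-Complex.I • ((Real.cos θ : ℂ) • generator (fun g => (W g : Matrix m m ℂ)) a
        + (Real.sin θ : ℂ) • generator (fun g => (W g : Matrix m m ℂ)) (a + 1))) 0 := by
    have h := (hscaleW (Real.cos θ) a).mul (hscaleW (Real.sin θ) (a + 1))
    simp only [mul_zero, rot_zero, map_one, OneMemClass.coe_one, mul_one, one_mul] at h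
    convert! h using 1
    · funext s; simp [hc]
    · rw [smul_add, smul_comm, smul_comm (-Complex.I)]; rfl
  have hcd2 : HasDerivAt (fun s => (c s : Matrix (Fin 2) (Fin 2) ℂ))
      (-(Complex.I / 2) • ((Real.cos θ : ℂ) • pauli a + (Real.sin θ : ℂ) • pauli (a + 1))) 0 := by
    have h := (hscaleR (Real.cos θ) a).mul (hscaleR (Real.sin θ) (a + 1))
    have hz : ∀ a, rotMatrix a 0 = 1 := fun a => congrArg Subtype.val (rot_zero a)
    simp only [mul_zero, hz, mul_one, one_mul] at h
    convert! h using 1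
    rw [smul_add, smul_comm, smul_comm (-(Complex.I / 2))]; rfl
  have hrd2 : HasDerivAt (fun s => (r s : Matrix (Fin 2) (Fin 2) ℂ))
      (-(Complex.I / 2) • ((Real.cos θ : ℂ) • pauli a + (Real.sin θ : ℂ) • pauli (a + 1))) 0 := by
    have h := ((hasDerivAt_rotMatrix a).const_mul (rotMatrix (a + 2) θ)).mul_const
      (rotMatrix (a + 2) (-θ))
    rw [Matrix.mul_smul, Matrix.smul_mul, rot_conj_tangent] at h
    exact h
  have hrd : HasDerivAt (fun s => (W (r s) : Matrix m m ℂ))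
      (-Complex.I • ((W (rot (a + 2) θ) : Matrix m m ℂ)
        * generator (fun g => (W g : Matrix m m ℂ)) a
        * (W (rot (a + 2) (-θ)) : Matrix m m ℂ))) 0 := by
    have h := ((hasDerivAt_generator W hW a).const_mul
      (W (rot (a + 2) θ) : Matrix m m ℂ)).mul_const (W (rot (a + 2) (-θ)) : Matrix m m ℂ)
    rw [Matrix.mul_smul, Matrix.smul_mul] at h
    convert! h using 1
    funext s; simp [hr]
  have h := hasDerivAt_rep_of_tangent W hW c r
    (by simp [hr, rot_zero, rot_neg])
    (by intro s t; simp [hr, rot_add, rot_neg, mul_assoc])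
    (by simp [hc, rot_zero]) hcd2 hrd2 hcd
  exact smul_right_injective _ (neg_ne_zero.2 Complex.I_ne_zero) (hrd.unique h)

/-- The angular momentum commutation relations. -/
theorem generator_commutator (hW : Continuous W) (a : Fin 3) :
    generator (fun g => (W g : Matrix m m ℂ)) (a + 2) * generator (fun g => (W g : Matrix m m ℂ)) a
      - generator (fun g => (W g : Matrix m m ℂ)) a
        * generator (fun g => (W g : Matrix m m ℂ)) (a + 2)
      = Complex.I • generator (fun g => (W g : Matrix m m ℂ)) (a + 1) := by
  have hd := hasDerivAt_generator W hW (a + 2)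
  have hd' : HasDerivAt (fun θ => (W (rot (a + 2) (-θ)) : Matrix m m ℂ))
      (-(-Complex.I • generator (fun g => (W g : Matrix m m ℂ)) (a + 2))) 0 := by
    have h' : HasDerivAt (fun θ => (W (rot (a + 2) θ) : Matrix m m ℂ))
      (-Complex.I • generator (fun g => (W g : Matrix m m ℂ)) (a + 2)) (-0) := by simpa using hd
    have := h'.scomp (0 : ℝ) (hasDerivAt_neg (0 : ℝ))
    simpa [Function.comp_def] using this
  -- Differentiating the rotation identity `rep_conj_generator` at θ = 0 turns it into the
  -- commutator.
  have h1 := (hd.mul_const (generator (fun g => (W g : Matrix m m ℂ)) a)).mul hd'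
  have hcos : HasDerivAt (fun θ : ℝ => (Real.cos θ : ℂ)) 0 0 := by
    simpa using (Real.hasDerivAt_cos 0).ofReal_comp
  have hsin : HasDerivAt (fun θ : ℝ => (Real.sin θ : ℂ)) 1 0 := by
    simpa using (Real.hasDerivAt_sin 0).ofReal_comp
  have h2 := (hcos.smul_const (generator (fun g => (W g : Matrix m m ℂ)) a)).add
    (hsin.smul_const (generator (fun g => (W g : Matrix m m ℂ)) (a + 1)))
  have h3 := h1.congr_of_eventuallyEq (Filter.Eventually.of_forall fun θ =>
    (rep_conj_generator W hW a θ).symm)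
  have h4 := h3.unique h2
  simp only [neg_zero, rot_zero, map_one, OneMemClass.coe_one, mul_one, one_mul, zero_smul,
    zero_add, one_smul, Matrix.mul_smul, neg_smul, neg_neg] at h4
  rw [← h4, neg_mul, Matrix.smul_mul, smul_add, smul_neg, smul_smul, smul_smul, Complex.I_mul_I]
  simp [sub_eq_add_neg]

omit [DecidableEq m] in
theorem commute_sum_sq {X Y Z : Matrix m m ℂ} (hZX : Z * X - X * Z = Complex.I • Y)
    (hXY : X * Y - Y * X = Complex.I • Z) : Commute (X * X + Y * Y + Z * Z) X := by
  have h : (X * X + Y * Y + Z * Z) * X - X * (X * X + Y * Y + Z * Z)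
      = Z * (Z * X - X * Z) + (Z * X - X * Z) * Z
        - (Y * (X * Y - Y * X) + (X * Y - Y * X) * Y) := by noncomm_ring
  rw [hZX, hXY] at h
  simp only [Matrix.mul_smul, Matrix.smul_mul] at h
  rw [add_comm (Complex.I • (Y * Z)), sub_self] at h
  exact sub_eq_zero.1 h

/-- The squared angular momentum commutes with every generator. -/
theorem angMomSq_commute_generator (hW : Continuous W) (a : Fin 3) :
    Commute (angMomSq fun g => (W g : Matrix m m ℂ))
      (generator (fun g => (W g : Matrix m m ℂ)) a) := by
  have h0 := generator_commutator W hW 0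
  have h1 := generator_commutator W hW 1
  have h2 := generator_commutator W hW 2
  simp only [Fin.isValue, zero_add, show (1 : Fin 3) + 2 = 0 from rfl,
    show (2 : Fin 3) + 2 = 1 from rfl, show (1 : Fin 3) + 1 = 2 from rfl,
    show (2 : Fin 3) + 1 = 0 from rfl] at h0 h1 h2
  simp only [angMomSq, Fin.sum_univ_three]
  fin_cases a
  · exact commute_sum_sq h0 h1
  · convert! commute_sum_sq h1 h2 using 1
    abel
  · convert! commute_sum_sq h2 h0 using 1
    abel

/-- The squared angular momentum commutes with rotations. -/
theorem angMomSq_commute_rep_rot (hW : Continuous W) (a : Fin 3) (t : ℝ) :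
    Commute (angMomSq fun g => (W g : Matrix m m ℂ)) (W (rot a t) : Matrix m m ℂ) := by
  rw [rep_rot_eq_exp W hW]
  exact (((angMomSq_commute_generator W hW a).smul_right _).smul_right _).exp_right

end Generators

/-! ### Spectral projectors -/

section SpectralProjectors

variable {m : Type*} [Fintype m] [DecidableEq m]

theorem toEuclideanLin_eigenProj (H : Matrix m m ℂ) (l : ℝ) :
    Matrix.toEuclideanLin (eigenProj H l)
      = ((Module.End.eigenspace (Matrix.toEuclideanLin H) (l : ℂ)).starProjection :
      EuclideanSpace ℂ m →ₗ[ℂ] EuclideanSpace ℂ m) :=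
  LinearEquiv.apply_symm_apply _ _

theorem eigenProj_isHermitian (H : Matrix m m ℂ) (l : ℝ) : (eigenProj H l).IsHermitian := by
  rw [← Matrix.isSymmetric_toEuclideanLin_iff, toEuclideanLin_eigenProj]
  exact Submodule.starProjection_isSymmetric _

theorem eigenProj_mulVec_of_eigenvector {H : Matrix m m ℂ} {l : ℝ} {v : m → ℂ}
    (hv : H *ᵥ v = (l : ℂ) • v) : eigenProj H l *ᵥ v = v := by
  have h1 : Matrix.toEuclideanLin (eigenProj H l) (WithLp.toLp 2 v) = WithLp.toLp 2 v := by
    rw [toEuclideanLin_eigenProj]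
    refine Submodule.starProjection_eq_self_iff.2 ?_
    rw [Module.End.mem_eigenspace_iff]
    exact congrArg (WithLp.toLp 2) hv
  exact congrArg WithLp.ofLp h1

theorem mul_eigenProj (H : Matrix m m ℂ) (l : ℝ) :
    H * eigenProj H l = (l : ℂ) • eigenProj H l := by
  refine Matrix.ext_iff_mulVec.2 fun v => ?_
  have h1 : Matrix.toEuclideanLin (eigenProj H l) (WithLp.toLp 2 v) ∈
      Module.End.eigenspace (Matrix.toEuclideanLin H) (l : ℂ) := by
    rw [toEuclideanLin_eigenProj]
    exact Submodule.starProjection_apply_mem _ _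
  rw [Module.End.mem_eigenspace_iff] at h1
  have h2 := congrArg WithLp.ofLp h1
  rw [← Matrix.mulVec_mulVec, Matrix.smul_mulVec]
  exact h2

theorem eigenProj_mul_of_mul_eq {H Y : Matrix m m ℂ} {l : ℝ} (hY : H * Y = (l : ℂ) • Y) :
    eigenProj H l * Y = Y := by
  refine Matrix.ext_iff_mulVec.2 fun v => ?_
  rw [← Matrix.mulVec_mulVec]
  apply eigenProj_mulVec_of_eigenvector
  rw [Matrix.mulVec_mulVec, hY, Matrix.smul_mulVec]

theorem eigenProj_mul_self (H : Matrix m m ℂ) (l : ℝ) :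
    eigenProj H l * eigenProj H l = eigenProj H l :=
  eigenProj_mul_of_mul_eq (mul_eigenProj H l)

theorem eigenProj_mul {H : Matrix m m ℂ} (hH : H.IsHermitian) (l : ℝ) :
    eigenProj H l * H = (l : ℂ) • eigenProj H l := by
  have h := congrArg conjTranspose (mul_eigenProj H l)
  rw [conjTranspose_mul, conjTranspose_smul, (eigenProj_isHermitian H l).eq, hH.eq] at h
  simpa using h

/-- A matrix commuting with H maps the eigenspace into itself, and so does its adjoint because H is
Hermitian; together these give commutation with the projector. -/
theorem eigenProj_commute {H X : Matrix m m ℂ} (hH : H.IsHermitian) (hX : Commute H X) (l : ℝ) :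
    Commute (eigenProj H l) X := by
  have key : ∀ X : Matrix m m ℂ, Commute H X →
      eigenProj H l * (X * eigenProj H l) = X * eigenProj H l := by
    intro X hX
    apply eigenProj_mul_of_mul_eq
    rw [← mul_assoc, hX.eq, mul_assoc, mul_eigenProj, Matrix.mul_smul]
  have hX' : Commute H Xᴴ := by
    have := congrArg conjTranspose hX.eq
    rw [conjTranspose_mul, conjTranspose_mul, hH.eq] at this
    exact this.symm
  have h2 := congrArg conjTranspose (key _ hX')
  rw [conjTranspose_mul, conjTranspose_mul, conjTranspose_conjTranspose,
    (eigenProj_isHermitian H l).eq, mul_assoc, key X hX] at h2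
  exact h2.symm

theorem eigenProj_mul_eigenProj_of_ne {H : Matrix m m ℂ} (hH : H.IsHermitian) {l l' : ℝ}
    (hl : l ≠ l') : eigenProj H l * eigenProj H l' = 0 := by
  have h1 : eigenProj H l * H * eigenProj H l' = (l : ℂ) • (eigenProj H l * eigenProj H l') := by
    rw [eigenProj_mul hH, Matrix.smul_mul]
  rw [mul_assoc, mul_eigenProj, Matrix.mul_smul] at h1
  have h2 : ((l' : ℂ) - l) • (eigenProj H l * eigenProj H l') = 0 := by
    rw [sub_smul, h1, sub_self]
  refine (smul_eq_zero.1 h2).resolve_left (sub_ne_zero.2 ?_)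
  exact_mod_cast hl.symm

/-- The finite set of eigenvalues of a Hermitian matrix. -/
noncomputable def eigenvalueSet {H : Matrix m m ℂ} (hH : H.IsHermitian) : Finset ℝ :=
  Finset.univ.image hH.eigenvalues

theorem sum_eigenProj {H : Matrix m m ℂ} (hH : H.IsHermitian) :
    ∑ l ∈ eigenvalueSet hH, eigenProj H l = 1 := by
  have hfix : ∀ i, (∑ l ∈ eigenvalueSet hH, eigenProj H l) *ᵥ (hH.eigenvectorBasis i).ofLp
      = (hH.eigenvectorBasis i).ofLp := by
    intro i
    have hi : eigenProj H (hH.eigenvalues i) *ᵥ (hH.eigenvectorBasis i).ofLp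
        = (hH.eigenvectorBasis i).ofLp :=
      eigenProj_mulVec_of_eigenvector (by
        rw [hH.mulVec_eigenvectorBasis]; rfl)
    rw [Matrix.sum_mulVec, Finset.sum_eq_single (hH.eigenvalues i), hi]
    · intro l _ hl
      rw [← hi, Matrix.mulVec_mulVec, eigenProj_mul_eigenProj_of_ne hH hl, Matrix.zero_mulVec]
    · intro h
      exact absurd (Finset.mem_image_of_mem _ (Finset.mem_univ i)) h
  have hU : (∑ l ∈ eigenvalueSet hH, eigenProj H l) * (hH.eigenvectorUnitary : Matrix m m ℂ)
      = hH.eigenvectorUnitary := by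
    ext i j
    have := congrFun (hfix j) i
    simpa [Matrix.mul_apply, Matrix.mulVec, dotProduct, hH.eigenvectorUnitary_apply] using this
  have h2 := congrArg (· * star (hH.eigenvectorUnitary : Matrix m m ℂ)) hU
  simpa [mul_assoc, Unitary.mul_star_self_of_mem hH.eigenvectorUnitary.2] using h2

theorem eigenProj_eq_zero_of_notMem {H : Matrix m m ℂ} (hH : H.IsHermitian) {l : ℝ}
    (hl : l ∉ eigenvalueSet hH) : eigenProj H l = 0 := by
  rw [← mul_one (eigenProj H l), ← sum_eigenProj hH, Finset.mul_sum]
  refine Finset.sum_eq_zero fun l' hl' => eigenProj_mul_eigenProj_of_ne hH ?_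
  rintro rfl
  exact hl hl'

theorem eigenProj_ne_zero_of_mem {H : Matrix m m ℂ} (hH : H.IsHermitian) {l : ℝ}
    (hl : l ∈ eigenvalueSet hH) : eigenProj H l ≠ 0 := by
  obtain ⟨i, -, rfl⟩ := Finset.mem_image.1 hl
  intro h0
  have hi : eigenProj H (hH.eigenvalues i) *ᵥ (hH.eigenvectorBasis i).ofLp
      = (hH.eigenvectorBasis i).ofLp :=
    eigenProj_mulVec_of_eigenvector (by rw [hH.mulVec_eigenvectorBasis]; rfl)
  rw [h0, Matrix.zero_mulVec] at hi
  exact hH.eigenvectorBasis.orthonormal.ne_zero i (congrArg (WithLp.toLp 2) hi.symm)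

/-- Each of the two Hermitian matrices fixes the range of the other; taking an adjoint identifies
them. -/
theorem eq_eigenProj {H P : Matrix m m ℂ} {l : ℝ} (hP : P.IsHermitian)
    (hHP : H * P = (l : ℂ) • P)
    (hfix : ∀ Y : Matrix m m ℂ, H * Y = (l : ℂ) • Y → P * Y = Y) : eigenProj H l = P := by
  have h1 := eigenProj_mul_of_mul_eq hHP
  have h2 := congrArg conjTranspose (hfix _ (mul_eigenProj H l))
  rw [conjTranspose_mul, hP.eq, (eigenProj_isHermitian H l).eq, h1] at h2
  exact h2.symm

theorem exists_natCast_eq_trace {E : Matrix m m ℂ} (hE : E * E = E) : ∃ n : ℕ, E.trace = n := by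
  have h : IsIdempotentElem (Matrix.toLin' E) := by
    rw [IsIdempotentElem, Module.End.mul_eq_comp, ← Matrix.toLin'_mul, hE]
  exact ⟨_, by rw [← Matrix.trace_toLin'_eq,
    (LinearMap.IsIdempotentElem.isProj_range _ h).trace]⟩

theorem eq_zero_of_trace_eq_zero {E : Matrix m m ℂ} (hE : E * E = E) (h0 : E.trace = 0) :
    E = 0 := by
  have h : IsIdempotentElem (Matrix.toLin' E) := by
    rw [IsIdempotentElem, Module.End.mul_eq_comp, ← Matrix.toLin'_mul, hE]
  rw [← Matrix.trace_toLin'_eq] at h0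
  have := LinearMap.IsIdempotentElem.eq_zero_of_trace_eq_zero h h0
  exact (LinearEquiv.map_eq_zero_iff _).1 this

end SpectralProjectors

/-! ### Weight multiplicities -/

section Weights

/-- The weights in an isotypic sector: the multiplicity is constant on a string `-j, …, j`. -/
theorem weight_string (f : ℝ → ℂ) (hfin : (Function.support f).Finite) (l : ℝ)
    (h : ∀ x, l ≠ x * (x + 1) → f x = f (x + 1)) {μ : ℝ} (hμ : f μ ≠ 0) :
    ∃ k n : ℕ, μ + k = (√(1 + 4 * l) - 1) / 2 ∧ μ - n = -((√(1 + 4 * l) - 1) / 2) ∧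
      (k + n + 1 : ℝ) = √(1 + 4 * l) ∧ (∀ i ≤ k, f (μ + i) = f μ) ∧
      ∀ i ≤ n, f (μ - i) = f μ := by
  have hup : ∀ k : ℕ, (∀ i < k, l ≠ (μ + i) * (μ + i + 1)) → ∀ i ≤ k, f (μ + i) = f μ := by
    intro k hk i
    induction i with
    | zero => simp
    | succ i ih =>
      intro hi
      have := h _ (hk i (by omega))
      push_cast
      rw [← add_assoc, ← this, ih (by omega)]
  have hdown : ∀ k : ℕ, (∀ i < k, l ≠ (μ - i - 1) * (μ - i)) → ∀ i ≤ k, f (μ - i) = f μ := by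
    intro k hk i
    induction i with
    | zero => simp
    | succ i ih =>
      intro hi
      have := h (μ - i - 1) (by rw [sub_add_cancel]; exact hk i (by omega))
      push_cast
      rw [← sub_sub, this, sub_add_cancel, ih (by omega)]
  -- A string that never meets a root of l = x(x + 1) would carry a nonzero constant on infinitely
  -- many points, against finite support.
  have hinf : ∀ g : ℕ → ℝ, Function.Injective g → ¬ ∀ i, f (g i) = f μ := by
    intro g hg hall
    refine Set.infinite_range_of_injective hg (hfin.subset ?_)
    rintro _ ⟨i, rfl⟩
    rw [Function.mem_support, hall i]
    exact hμ
  have hex1 : ∃ k : ℕ, l = (μ + k) * (μ + k + 1) := by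
    by_contra! hcon
    refine hinf (fun i => μ + i) (fun a b hab => by simpa using hab) fun i => ?_
    exact hup i (fun j _ => hcon j) i le_rfl
  have hex2 : ∃ k : ℕ, l = (μ - k - 1) * (μ - k) := by
    by_contra! hcon
    refine hinf (fun i => μ - i) (fun a b hab => by simpa using hab) fun i => ?_
    exact hdown i (fun j _ => hcon j) i le_rfl
  classical
  set k := Nat.find hex1
  set n := Nat.find hex2
  have hk : l = (μ + k) * (μ + k + 1) := Nat.find_spec hex1
  have hn : l = (μ - n - 1) * (μ - n) := Nat.find_spec hex2
  have hk0 : (0 : ℝ) ≤ k := Nat.cast_nonneg k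
  have hn0 : (0 : ℝ) ≤ n := Nat.cast_nonneg n
  -- Both ends solve the same quadratic. The difference of the two equations factors, and the
  -- positive factor cancels, so the string is symmetric about 0.
  have h1 : ((k : ℝ) + n + 1) * (2 * μ + k - n) = 0 := by linear_combination hn - hk
  have h2 : 2 * μ + k - n = 0 := (mul_eq_zero.1 h1).resolve_left (by positivity)
  have h3 : √(1 + 4 * l) = k + n + 1 := by
    rw [Real.sqrt_eq_iff_mul_self_eq_of_pos (by positivity)]
    have : μ = (n - k) / 2 := by linarith
    rw [hk, this]; ring
  refine ⟨k, n, by rw [h3]; linarith, by rw [h3]; linarith, h3.symm,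
    hup k fun i hi => Nat.find_min hex1 hi, hdown n fun i hi => Nat.find_min hex2 hi⟩

variable {m : Type*} [Fintype m] [DecidableEq m]

/-- Hermitian matrices satisfying the angular momentum commutation relations. -/
structure IsAngMom (J : Fin 3 → Matrix m m ℂ) : Prop where
  herm : ∀ a, (J a).IsHermitian
  comm : ∀ a, J (a + 2) * J a - J a * J (a + 2) = Complex.I • J (a + 1)
  commute_sq : ∀ a, Commute (∑ b, J b * J b) (J a)

theorem isAngMom_generator (W : SU2 →* Matrix.unitaryGroup m ℂ) (hW : Continuous W) :
    IsAngMom (generator fun g => (W g : Matrix m m ℂ)) :=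
  ⟨isHermitian_generator W hW, generator_commutator W hW, angMomSq_commute_generator W hW⟩

/-- The multiplicity of the weight `x` in the sector with `J² = l`. -/
noncomputable def weightMult (J : Fin 3 → Matrix m m ℂ) (l x : ℝ) : ℂ :=
  (eigenProj (∑ b, J b * J b) l * eigenProj (J 2) x).trace

namespace IsAngMom

variable {J : Fin 3 → Matrix m m ℂ} (hJ : IsAngMom J)

include hJ

omit [DecidableEq m] in
theorem sq_isHermitian : (∑ b, J b * J b).IsHermitian := by
  rw [Matrix.IsHermitian, conjTranspose_sum]
  refine Finset.sum_congr rfl fun b _ => ?_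
  rw [conjTranspose_mul, (hJ.herm b).eq]

/-- With R = J_x + iJ_y and L its adjoint, R moves weight x to x + 1 inside the sector, so tr(PQ·LR)
= tr(PQ'·RL) by cyclicity. On the respective weight spaces LR and RL are both the scalar l - x(x +
1), which cancels when it is nonzero. -/
theorem weightMult_succ {l x : ℝ} (hl : l ≠ x * (x + 1)) :
    weightMult J l x = weightMult J l (x + 1) := by
  have hc0 := hJ.comm 0
  have hc1 := hJ.comm 1
  have hc2 := hJ.comm 2
  simp only [Fin.isValue, zero_add, show (1 : Fin 3) + 2 = 0 from rfl,
    show (2 : Fin 3) + 2 = 1 from rfl, show (1 : Fin 3) + 1 = 2 from rfl,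
    show (2 : Fin 3) + 1 = 0 from rfl] at hc0 hc1 hc2
  set C := ∑ b, J b * J b with hC
  have hCsum : C = J 0 * J 0 + J 1 * J 1 + J 2 * J 2 := by rw [hC, Fin.sum_univ_three]
  set P := eigenProj C l with hP
  set Q := eigenProj (J 2) x with hQ
  set Q' := eigenProj (J 2) (x + 1) with hQ'
  set R := J 0 + Complex.I • J 1 with hR
  set L := J 0 - Complex.I • J 1 with hL
  have hRH : Rᴴ = L := by
    rw [hR, hL, conjTranspose_add, conjTranspose_smul, (hJ.herm 0).eq, (hJ.herm 1).eq]
    simp [sub_eq_add_neg]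
  have hI2 : ∀ X : Matrix m m ℂ, Complex.I • Complex.I • X = -X := fun X => by
    rw [smul_smul, Complex.I_mul_I, neg_one_smul]
  have hJR : J 2 * R = R * J 2 + R := by
    rw [sub_eq_iff_eq_add] at hc0
    have h2 : J 2 * J 1 = J 1 * J 2 - Complex.I • J 0 := by rw [← hc2]; abel
    simp only [hR, Matrix.mul_add, Matrix.add_mul, Matrix.mul_smul, Matrix.smul_mul, hc0, h2,
      smul_sub, hI2]
    abel
  have hLJ : J 2 * L = L * J 2 - L := by
    rw [sub_eq_iff_eq_add] at hc0
    have h2 : J 2 * J 1 = J 1 * J 2 - Complex.I • J 0 := by rw [← hc2]; abel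
    simp only [hL, Matrix.mul_sub, Matrix.sub_mul, Matrix.mul_smul, Matrix.smul_mul, hc0, h2,
      smul_sub, hI2]
    abel
  have hLR : L * R = C - J 2 * J 2 - J 2 := by
    have h2 : J 0 * J 1 = J 1 * J 0 + Complex.I • J 2 := by rw [← hc1]; abel
    simp only [hL, hR, Matrix.mul_add, Matrix.sub_mul, Matrix.mul_smul, Matrix.smul_mul, h2,
      smul_add, smul_sub, hI2, hCsum]
    abel
  have hRL : R * L = C - J 2 * J 2 + J 2 := by
    have h2 : J 0 * J 1 = J 1 * J 0 + Complex.I • J 2 := by rw [← hc1]; abel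
    simp only [hL, hR, Matrix.add_mul, Matrix.mul_sub, Matrix.mul_smul, Matrix.smul_mul, h2,
      smul_add, hI2, hCsum]
    abel
  have h1 : Q' * (R * Q) = R * Q := by
    apply eigenProj_mul_of_mul_eq
    rw [← mul_assoc, hJR, Matrix.add_mul, mul_assoc, hQ, mul_eigenProj, Matrix.mul_smul]
    push_cast
    rw [add_smul, one_smul]
  have h2 : Q * (L * Q') = L * Q' := by
    apply eigenProj_mul_of_mul_eq
    rw [← mul_assoc, hLJ, Matrix.sub_mul, mul_assoc, hQ', mul_eigenProj, Matrix.mul_smul]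
    push_cast
    rw [add_smul, one_smul]
    abel
  -- `h1` gives Q'RQ = RQ, and the adjoint of `h2` gives Q'RQ = Q'R.
  have hRQ : R * Q = Q' * R := by
    have h3 := congrArg conjTranspose h2
    rw [conjTranspose_mul, conjTranspose_mul, ← hRH, conjTranspose_conjTranspose,
      (eigenProj_isHermitian _ _).eq, (eigenProj_isHermitian _ _).eq, mul_assoc] at h3
    rw [← h1, h3]
  have hPR : P * R = R * P :=
    (eigenProj_commute hJ.sq_isHermitian
      ((hJ.commute_sq 0).add_right ((hJ.commute_sq 1).smul_right _)) l).eq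
  have hPC : P * C = (l : ℂ) • P := eigenProj_mul hJ.sq_isHermitian l
  have hPJ : P * J 2 = J 2 * P := (eigenProj_commute hJ.sq_isHermitian (hJ.commute_sq 2) l).eq
  have hCQ : ∀ y, C * eigenProj (J 2) y = eigenProj (J 2) y * C := fun y =>
    (eigenProj_commute (hJ.herm 2) (hJ.commute_sq 2).symm y).eq.symm
  have e1 : (P * Q * (L * R)).trace = ((l : ℂ) - x * x - x) * (P * Q).trace := by
    have : P * Q * (L * R) = ((l : ℂ) - x * x - x) • (P * Q) := by
      rw [hLR, Matrix.mul_sub, Matrix.mul_sub, mul_assoc P Q C, ← hCQ, ← mul_assoc P C, hPC,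
        ← mul_assoc, mul_assoc P Q, hQ, eigenProj_mul (hJ.herm 2), Matrix.mul_smul,
        Matrix.smul_mul, Matrix.smul_mul, mul_assoc P _ (J 2), eigenProj_mul (hJ.herm 2),
        Matrix.mul_smul, smul_smul, sub_smul, sub_smul]
    rw [this, trace_smul, smul_eq_mul]
  have e2 : (P * Q' * (R * L)).trace = ((l : ℂ) - x * x - x) * (P * Q').trace := by
    have : P * Q' * (R * L) = ((l : ℂ) - x * x - x) • (P * Q') := by
      rw [hRL, Matrix.mul_add, Matrix.mul_sub, mul_assoc P Q' C, ← hCQ, ← mul_assoc P C, hPC,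
        ← mul_assoc, mul_assoc P Q', hQ', eigenProj_mul (hJ.herm 2), Matrix.mul_smul,
        Matrix.smul_mul, Matrix.smul_mul, mul_assoc P _ (J 2), eigenProj_mul (hJ.herm 2),
        Matrix.mul_smul, smul_smul, ← sub_smul, ← add_smul]
      congr 1
      push_cast
      ring
    rw [this, trace_smul, smul_eq_mul]
  have e3 : (P * Q * (L * R)).trace = (P * Q' * (R * L)).trace := by
    rw [← mul_assoc, trace_mul_comm, ← mul_assoc, ← mul_assoc, ← hPR, mul_assoc P R Q, hRQ,
      mul_assoc, mul_assoc, mul_assoc]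
  have h4 : ((l : ℂ) - x * x - x) ≠ 0 := by
    have : l - x * x - x ≠ 0 := fun h0 => hl (by linarith)
    exact_mod_cast this
  rw [e1, e2] at e3
  exact mul_left_cancel₀ h4 e3

theorem exists_weightMult_eq (l x : ℝ) : ∃ n : ℕ, weightMult J l x = n := by
  apply exists_natCast_eq_trace
  have hc : Commute (eigenProj (∑ b, J b * J b) l) (eigenProj (J 2) x) :=
    (eigenProj_commute hJ.sq_isHermitian
      (eigenProj_commute (hJ.herm 2) (hJ.commute_sq 2).symm x).symm l)
  rw [mul_assoc, ← mul_assoc (eigenProj (J 2) x), ← hc.eq, mul_assoc, eigenProj_mul_self,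
    ← mul_assoc, eigenProj_mul_self]

theorem weightMult_nonneg (l x : ℝ) : 0 ≤ (weightMult J l x).re := by
  obtain ⟨n, hn⟩ := hJ.exists_weightMult_eq l x
  simp [hn]

theorem support_weightMult (l : ℝ) :
    Function.support (weightMult J l) ⊆ eigenvalueSet (hJ.herm 2) := by
  intro x hx
  by_contra hmem
  exact hx (by rw [weightMult, eigenProj_eq_zero_of_notMem (hJ.herm 2) hmem]; simp)

theorem weightMult_string {l x : ℝ} (hx : weightMult J l x ≠ 0) :
    ∃ k n : ℕ, x + k = (√(1 + 4 * l) - 1) / 2 ∧ x - n = -((√(1 + 4 * l) - 1) / 2) ∧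
      (k + n + 1 : ℝ) = √(1 + 4 * l) ∧ (∀ i ≤ k, weightMult J l (x + i) = weightMult J l x) ∧
      ∀ i ≤ n, weightMult J l (x - i) = weightMult J l x :=
  weight_string _ ((Finset.finite_toSet _).subset (hJ.support_weightMult l)) l
    (fun _ h => hJ.weightMult_succ h) hx

theorem sum_weightMult_left (l : ℝ) :
    ∑ x ∈ eigenvalueSet (hJ.herm 2), weightMult J l x = (eigenProj (∑ b, J b * J b) l).trace := by
  simp only [weightMult]
  rw [← trace_sum, ← Finset.mul_sum, sum_eigenProj, mul_one]

theorem sum_weightMult_right (x : ℝ) :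
    ∑ l ∈ eigenvalueSet hJ.sq_isHermitian, weightMult J l x = (eigenProj (J 2) x).trace := by
  simp only [weightMult]
  rw [← trace_sum, ← Finset.sum_mul, sum_eigenProj, one_mul]

/-- A nonzero sector has dimension at least `2j + 1`. -/
theorem sqrt_le_trace {l : ℝ} (hl : eigenProj (∑ b, J b * J b) l ≠ 0) :
    √(1 + 4 * l) ≤ (eigenProj (∑ b, J b * J b) l).trace.re := by
  have hne : (eigenProj (∑ b, J b * J b) l).trace ≠ 0 := fun h0 =>
    hl (eq_zero_of_trace_eq_zero (eigenProj_mul_self _ _) h0)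
  rw [← hJ.sum_weightMult_left] at hne
  obtain ⟨x, hxs, hx⟩ := Finset.exists_ne_zero_of_sum_ne_zero hne
  obtain ⟨k, n, -, -, hkn, hk, hn⟩ := hJ.weightMult_string hx
  -- The k + n + 1 = 2j + 1 weights of the string, listed upwards from the lowest one x - n, share
  -- one positive integer multiplicity.
  have hval : ∀ i ∈ Finset.range (k + n + 1), weightMult J l (x - n + i) = weightMult J l x := by
    intro i hi
    rw [Finset.mem_range] at hi
    rcases le_total i n with h | h
    · rw [← hn (n - i) (by omega), Nat.cast_sub h]; congr 1; ring
    · rw [← hk (i - n) (by omega), Nat.cast_sub h]; congr 1; ring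
  have hinj : Set.InjOn (fun i : ℕ => x - n + (i : ℝ)) (Finset.range (k + n + 1)) := by
    intro a _ b _ hab
    simpa using hab
  have hsub : (Finset.range (k + n + 1)).image (fun i : ℕ => x - n + (i : ℝ))
      ⊆ eigenvalueSet (hJ.herm 2) := by
    intro y hy
    obtain ⟨i, hi, rfl⟩ := Finset.mem_image.1 hy
    exact hJ.support_weightMult l (by rw [Function.mem_support, hval i hi]; exact hx)
  have h1 : (1 : ℝ) ≤ (weightMult J l x).re := by
    obtain ⟨c, hc⟩ := hJ.exists_weightMult_eq l x
    rw [hc] at hx ⊢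
    have : c ≠ 0 := by exact_mod_cast hx
    simpa using Nat.one_le_iff_ne_zero.2 this
  calc √(1 + 4 * l) = ∑ i ∈ Finset.range (k + n + 1), (1 : ℝ) := by
        rw [← hkn]; simp
    _ ≤ ∑ i ∈ Finset.range (k + n + 1), (weightMult J l (x - n + i)).re :=
        Finset.sum_le_sum fun i hi => by rw [hval i hi]; exact h1
    _ = ∑ y ∈ (Finset.range (k + n + 1)).image (fun i : ℕ => x - n + (i : ℝ)),
          (weightMult J l y).re := (Finset.sum_image (f := fun y => (weightMult J l y).re) hinj).symm
    _ ≤ ∑ y ∈ eigenvalueSet (hJ.herm 2), (weightMult J l y).re :=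
        Finset.sum_le_sum_of_subset_of_nonneg hsub fun y _ _ => hJ.weightMult_nonneg l y
    _ = (eigenProj (∑ b, J b * J b) l).trace.re := by
        rw [← hJ.sum_weightMult_left, Complex.re_sum]

/-- There are few sectors with large angular momentum. -/
theorem card_mul_le {s : ℝ} :
    (((eigenvalueSet hJ.sq_isHermitian).filter (fun l => s ^ 2 ≤ l)).card : ℝ) * (2 * s)
      ≤ Fintype.card m := by
  have hnn : ∀ l, 0 ≤ (eigenProj (∑ b, J b * J b) l).trace.re := by
    intro l
    obtain ⟨n, hn⟩ := exists_natCast_eq_trace (eigenProj_mul_self (∑ b, J b * J b) l)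
    simp [hn]
  calc _ = ∑ l ∈ (eigenvalueSet hJ.sq_isHermitian).filter (fun l => s ^ 2 ≤ l), 2 * s := by
        rw [Finset.sum_const, nsmul_eq_mul]
    _ ≤ ∑ l ∈ (eigenvalueSet hJ.sq_isHermitian).filter (fun l => s ^ 2 ≤ l),
          (eigenProj (∑ b, J b * J b) l).trace.re := by
        refine Finset.sum_le_sum fun l hl => ?_
        rw [Finset.mem_filter] at hl
        refine le_trans ?_ (hJ.sqrt_le_trace (eigenProj_ne_zero_of_mem _ hl.1))
        exact Real.le_sqrt_of_sq_le (by linarith [hl.2])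
    _ ≤ ∑ l ∈ eigenvalueSet hJ.sq_isHermitian, (eigenProj (∑ b, J b * J b) l).trace.re :=
        Finset.sum_le_sum_of_subset_of_nonneg (Finset.filter_subset _ _) fun l _ _ => hnn l
    _ = Fintype.card m := by
        rw [← Complex.re_sum, ← trace_sum, sum_eigenProj, trace_one]
        simp

end IsAngMom

end Weights

/-! ### The binomial distribution -/

section Binomial

/-- The probability mass function of the binomial distribution. -/
noncomputable def binomialMass (N : ℕ) (p : ℝ) (h : ℕ) : ℝ :=
  (N.choose h : ℝ) * (p ^ h * (1 - p) ^ (N - h))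

variable {p : ℝ}

theorem binomialMass_nonneg (hp0 : 0 ≤ p) (hp1 : p ≤ 1) (N h : ℕ) : 0 ≤ binomialMass N p h := by
  have : 0 ≤ 1 - p := by linarith
  unfold binomialMass
  positivity

theorem binomialMass_eq_zero {N h : ℕ} (hh : N < h) : binomialMass N p h = 0 := by
  simp [binomialMass, Nat.choose_eq_zero_of_lt hh]

theorem sum_binomialMass (N : ℕ) : ∑ h ∈ Finset.range (N + 1), binomialMass N p h = 1 := by
  have := add_pow p (1 - p) N
  rw [add_sub_cancel, one_pow] at this
  rw [this]
  refine Finset.sum_congr rfl fun h _ => ?_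
  rw [binomialMass]; ring

theorem binomialMass_symm {N h : ℕ} (hh : h ≤ N) :
    binomialMass N p h = binomialMass N (1 - p) (N - h) := by
  rw [binomialMass, binomialMass, Nat.choose_symm hh, Nat.sub_sub_self hh, sub_sub_cancel]
  ring

theorem binomialMass_succ (N h : ℕ) :
    binomialMass N p (h + 1) * ((h + 1) * (1 - p)) = binomialMass N p h * ((N - h) * p) := by
  rcases lt_trichotomy h N with hh | rfl | hh
  · have h1 : (N.choose (h + 1) : ℝ) * (h + 1) = N.choose h * (N - h) := by
      have := Nat.choose_succ_right_eq N h
      rw [← Nat.cast_sub hh.le]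
      exact_mod_cast this
    have h2 : (1 - p) ^ (N - h) = (1 - p) ^ (N - (h + 1)) * (1 - p) := by
      rw [← pow_succ]; congr 1; omega
    rw [binomialMass, binomialMass, h2, pow_succ]
    linear_combination (p ^ h * p * (1 - p) ^ (N - (h + 1)) * (1 - p)) * h1
  · rw [binomialMass_eq_zero (Nat.lt_succ_self h)]; simp
  · rw [binomialMass_eq_zero hh, binomialMass_eq_zero (by omega)]; simp

theorem sum_binomialMass_le (hp0 : 0 ≤ p) (hp1 : p ≤ 1) (N h t : ℕ) :
    ∑ i ∈ Finset.range t, binomialMass N p (h + i) ≤ 1 := by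
  have h1 : ∑ i ∈ Finset.range t, binomialMass N p (h + i)
      ≤ ∑ j ∈ Finset.range (h + t), binomialMass N p j := by
    rw [Finset.sum_range_add]
    exact le_add_of_nonneg_left (Finset.sum_nonneg fun i _ => binomialMass_nonneg hp0 hp1 N i)
  refine h1.trans ?_
  rw [← sum_binomialMass (p := p) N]
  have h2 : ∑ j ∈ Finset.range (h + t), binomialMass N p j
      ≤ ∑ j ∈ Finset.range (N + 1 + (h + t)), binomialMass N p j :=
    Finset.sum_le_sum_of_subset_of_nonneg (by
      intro i hi; simp only [Finset.mem_range] at hi ⊢; omega)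
      fun i _ _ => binomialMass_nonneg hp0 hp1 N i
  refine h2.trans (le_of_eq ?_)
  rw [Finset.sum_range_add, add_eq_left]
  exact Finset.sum_eq_zero fun i _ => binomialMass_eq_zero (by omega)

/-- Starting at or below the mean, the next t masses lose at most a factor 1 - δ per step with tδ ≤
1/2. By Bernoulli's inequality each is at least half of the first, and their sum is at most 1. -/
theorem binomialMass_le_of_le (hp0 : 0 < p) (hp1 : p < 1) {N h t : ℕ} (hN : 0 < N)
    (hh : (h : ℝ) ≤ N * p) (ht : (t : ℝ) * (t + 1) ≤ N * p * (1 - p) / 2) :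
    t * binomialMass N p h ≤ 2 := by
  have hq : 0 < 1 - p := by linarith
  have hN' : (0 : ℝ) < N := by exact_mod_cast hN
  have hV : 0 < (N : ℝ) * p * (1 - p) := by positivity
  set δ : ℝ := (t + 1) / (N * p * (1 - p)) with hδ
  have hδV : δ * (N * p * (1 - p)) = t + 1 := by rw [hδ]; field_simp
  have hδ0 : 0 ≤ δ := by positivity
  have htδ : t * δ ≤ 1 / 2 := by
    rw [hδ, mul_div_assoc', div_le_iff₀ hV]; linarith
  have hstep : ∀ i < t, (1 - δ) * binomialMass N p (h + i) ≤ binomialMass N p (h + i + 1) := by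
    intro i hi
    have hb := binomialMass_succ (p := p) N (h + i)
    have hb0 := binomialMass_nonneg hp0.le hp1.le N (h + i)
    have hpos : 0 < (((h + i : ℕ) : ℝ) + 1) * (1 - p) := by positivity
    refine le_of_mul_le_mul_right ?_ hpos
    rw [hb, mul_comm (1 - δ), mul_assoc]
    refine mul_le_mul_of_nonneg_left ?_ hb0
    have hit : (i : ℝ) ≤ t := by exact_mod_cast hi.le
    set y : ℝ := ((h + i : ℕ) : ℝ) with hy
    have hyt : y ≤ N * p + t := by rw [hy]; push_cast; linarith
    rcases le_total ((y + 1) * (1 - p)) ((N - y) * p) with hc | hc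
    · have : 0 ≤ δ * ((y + 1) * (1 - p)) := mul_nonneg hδ0 hpos.le
      nlinarith
    -- If the mass decreases at y, then y + 1 ≥ Np, and the deficit (y + 1)(1 - p) - (N - y)p = y +
    -- 1 - p - Np is at most t + 1 = δNp(1 - p).
    · have h3 : N * p * (1 - p) ≤ (y + 1) * (1 - p) := by nlinarith
      have h4 : δ * (N * p * (1 - p)) ≤ δ * ((y + 1) * (1 - p)) :=
        mul_le_mul_of_nonneg_left h3 hδ0
      nlinarith
  rcases Nat.eq_zero_or_pos t with rfl | htpos
  · simp
  have ht1 : (1 : ℝ) ≤ t := by exact_mod_cast htpos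
  have hδ1 : δ ≤ 1 := by nlinarith
  have hlow : ∀ i ≤ t, (1 - δ) ^ i * binomialMass N p h ≤ binomialMass N p (h + i) := by
    intro i
    induction i with
    | zero => simp
    | succ i ih =>
      intro hi
      refine le_trans ?_ (hstep i (by omega))
      rw [pow_succ', mul_assoc]
      exact mul_le_mul_of_nonneg_left (ih (by omega)) (by linarith)
  have hhalf : ∀ i ≤ t, binomialMass N p h / 2 ≤ binomialMass N p (h + i) := by
    intro i hi
    refine le_trans ?_ (hlow i hi)
    have hbern := one_add_mul_le_pow (a := -δ) (by linarith) i
    have hit : (i : ℝ) * δ ≤ t * δ := mul_le_mul_of_nonneg_right (by exact_mod_cast hi) hδ0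
    have : (1 / 2 : ℝ) ≤ (1 - δ) ^ i := by
      rw [← sub_eq_add_neg] at hbern
      linarith
    have hb0 := binomialMass_nonneg hp0.le hp1.le N h
    nlinarith
  have hsum := sum_binomialMass_le hp0.le hp1.le N h t
  have hge : ∑ i ∈ Finset.range t, binomialMass N p h / 2
      ≤ ∑ i ∈ Finset.range t, binomialMass N p (h + i) :=
    Finset.sum_le_sum fun i hi => hhalf i (Finset.mem_range.1 hi).le
  rw [Finset.sum_const, Finset.card_range, nsmul_eq_mul] at hge
  linarith

theorem binomialMass_le_one (hp0 : 0 ≤ p) (hp1 : p ≤ 1) (N h : ℕ) : binomialMass N p h ≤ 1 := by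
  simpa using sum_binomialMass_le hp0 hp1 N h 1

/-- The binomial probabilities are at most of order `1 / √N`. -/
theorem binomialMass_le (hp0 : 0 < p) (hp1 : p < 1) {N : ℕ} (hN : 0 < N) (h : ℕ) :
    binomialMass N p h ≤ 8 / √(N * p * (1 - p)) := by
  have hq : 0 < 1 - p := by linarith
  have hN' : (0 : ℝ) < N := by exact_mod_cast hN
  have hV : 0 < (N : ℝ) * p * (1 - p) := by positivity
  have hs0 : 0 < √(N * p * (1 - p)) := Real.sqrt_pos.2 hV
  have hsq := Real.sq_sqrt hV.le
  set s := √(N * p * (1 - p)) with hs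
  rw [le_div_iff₀ hs0]
  rcases lt_or_ge s 2 with hs2 | hs2
  · have := binomialMass_le_one hp0.le hp1.le N h
    have := binomialMass_nonneg hp0.le hp1.le N h
    nlinarith
  -- For s ≥ 2 this t satisfies t(t + 1) ≤ s²/2 and s ≤ 4t, so the bound 2 for t times the mass
  -- becomes 8 for s times the mass. Points above the mean are reflected by h ↦ N - h, p ↦ 1 - p.
  set t := ⌊s / 2⌋₊ with ht
  have ht1 : (t : ℝ) ≤ s / 2 := Nat.floor_le (by positivity)
  have ht2 : s / 2 < t + 1 := Nat.lt_floor_add_one _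
  have ht3 : (1 : ℝ) ≤ t := by
    have : 1 ≤ t := Nat.le_floor (by push_cast; linarith)
    exact_mod_cast this
  have ht0 : (0 : ℝ) ≤ t := Nat.cast_nonneg t
  have htt : (t : ℝ) * (t + 1) ≤ N * p * (1 - p) / 2 := by nlinarith
  have key : t * binomialMass N p h ≤ 2 := by
    rcases le_or_gt h N with hhN | hhN
    · rcases le_total (h : ℝ) (N * p) with hle | hle
      · exact binomialMass_le_of_le hp0 hp1 hN hle htt
      · rw [binomialMass_symm hhN]
        refine binomialMass_le_of_le hq (by linarith) hN ?_ ?_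
        · rw [Nat.cast_sub hhN]; linarith
        · rw [sub_sub_cancel]; linarith
    · rw [binomialMass_eq_zero hhN]; simp
  have := binomialMass_nonneg hp0.le hp1.le N h
  nlinarith

theorem sum_sq_mul_binomialMass (N : ℕ) :
    ∑ h ∈ Finset.range (N + 1), (N * p - h) ^ 2 * binomialMass N p h = N * p * (1 - p) := by
  have := congrArg (Polynomial.eval p) (bernsteinPolynomial.variance ℝ N)
  simp only [Polynomial.eval_finsetSum, Polynomial.eval_mul, Polynomial.eval_pow,
    Polynomial.eval_sub, Polynomial.eval_X, Polynomial.eval_one, Polynomial.eval_natCast,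
    bernsteinPolynomial, nsmul_eq_mul] at this
  rw [← this]
  refine Finset.sum_congr rfl fun h _ => ?_
  rw [binomialMass]; ring

/-- Chebyshev's inequality for the lower tail. -/
theorem sum_binomialMass_tail_le (hp0 : 0 ≤ p) (hp1 : p ≤ 1) {N : ℕ} {s : ℝ} (hs : 0 < s) :
    ∑ h ∈ (Finset.range (N + 1)).filter (fun h : ℕ => s ≤ N * p - h), binomialMass N p h
      ≤ N * p * (1 - p) / s ^ 2 := by
  rw [le_div_iff₀ (by positivity), ← sum_sq_mul_binomialMass, Finset.sum_mul]
  calc _ ≤ ∑ h ∈ (Finset.range (N + 1)).filter (fun h : ℕ => s ≤ N * p - h),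
        (N * p - h) ^ 2 * binomialMass N p h := by
        refine Finset.sum_le_sum fun h hh => ?_
        rw [Finset.mem_filter] at hh
        rw [mul_comm]
        exact mul_le_mul_of_nonneg_right (pow_le_pow_left₀ hs.le hh.2 2)
          (binomialMass_nonneg hp0 hp1 N h)
    _ ≤ _ := Finset.sum_le_sum_of_subset_of_nonneg (Finset.filter_subset _ _) fun h _ _ =>
        mul_nonneg (sq_nonneg _) (binomialMass_nonneg hp0 hp1 N h)

end Binomial

/-! ### Tensor powers -/

section TensorPow

theorem tensorPow_mul (N : ℕ) (A B : Matrix (Fin 2) (Fin 2) ℂ) :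
    tensorPow N (A * B) = tensorPow N A * tensorPow N B := by
  ext x y
  simp only [tensorPow, Matrix.of_apply, Matrix.mul_apply]
  rw [Finset.prod_univ_sum, Fintype.piFinset_univ]
  exact Finset.sum_congr rfl fun z _ => Finset.prod_mul_distrib

theorem tensorPow_diagonal (N : ℕ) (d : Fin 2 → ℂ) :
    tensorPow N (Matrix.diagonal d) = Matrix.diagonal fun x => ∏ k, d (x k) := by
  ext x y
  rcases eq_or_ne x y with rfl | hxy
  · simp [tensorPow]
  · obtain ⟨k, hk⟩ := Function.ne_iff.1 hxy
    rw [Matrix.diagonal_apply_ne _ hxy, tensorPow, Matrix.of_apply]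
    exact Finset.prod_eq_zero (Finset.mem_univ k) (Matrix.diagonal_apply_ne _ hk)

theorem tensorPow_one (N : ℕ) : tensorPow N 1 = 1 := by
  rw [← Matrix.diagonal_one, tensorPow_diagonal]
  simp

theorem tensorPow_conjTranspose (N : ℕ) (A : Matrix (Fin 2) (Fin 2) ℂ) :
    tensorPow N Aᴴ = (tensorPow N A)ᴴ := by
  ext x y
  simp [tensorPow]

/-- The tensor representation of `SU(2)` on `N` qubits, as a homomorphism. -/
noncomputable def qubitsHom (N : ℕ) : SU2 →* Matrix.unitaryGroup (Fin N → Fin 2) ℂ where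
  toFun g := ⟨qubitsRep N g, by
    rw [Matrix.mem_unitaryGroup_iff, Matrix.star_eq_conjTranspose, qubitsRep,
      ← tensorPow_conjTranspose, ← tensorPow_mul, ← Matrix.star_eq_conjTranspose,
      Matrix.mem_unitaryGroup_iff.1 (Matrix.mem_specialUnitaryGroup_iff.1 g.2).1, tensorPow_one]⟩
  map_one' := Subtype.ext (tensorPow_one N)
  map_mul' g h := Subtype.ext (tensorPow_mul N g h)

theorem continuous_tensorPow (N : ℕ) : Continuous (tensorPow N) := by
  unfold tensorPow
  fun_prop

theorem continuous_qubitsHom (N : ℕ) : Continuous (qubitsHom N) :=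
  Continuous.subtype_mk ((continuous_tensorPow N).comp continuous_subtype_val) _

theorem isAngMom_qubits (N : ℕ) : IsAngMom (generator (qubitsRep N)) :=
  isAngMom_generator (qubitsHom N) (continuous_qubitsHom N)

end TensorPow

/-! ### The computational basis -/

section Basis

/-- The number of spins pointing up in a computational basis state. -/
def numUp {N : ℕ} (x : Fin N → Fin 2) : ℕ := (Finset.univ.filter fun k => x k = 0).card

theorem numUp_le {N : ℕ} (x : Fin N → Fin 2) : numUp x ≤ N :=
  (Finset.card_filter_le _ _).trans (by simp)

theorem prod_eq_numUp {N : ℕ} (x : Fin N → Fin 2) (a b : ℂ) :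
    ∏ k, (![a, b] : Fin 2 → ℂ) (x k) = a ^ numUp x * b ^ (N - numUp x) := by
  have h : ∀ k, (![a, b] : Fin 2 → ℂ) (x k) = if x k = 0 then a else b := by
    intro k
    rcases Fin.exists_fin_two.1 ⟨x k, rfl⟩ with hk | hk <;> simp [hk]
  simp only [h]
  rw [Finset.prod_ite, Finset.prod_const, Finset.prod_const]
  congr 2
  have := Finset.card_filter_add_card_filter_not (s := (Finset.univ : Finset (Fin N)))
    (fun k => x k = 0)
  rw [Finset.card_univ, Fintype.card_fin] at this
  rw [numUp]; omega

theorem card_numUp_eq (N h : ℕ) :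
    (Finset.univ.filter fun x : Fin N → Fin 2 => numUp x = h).card = N.choose h := by
  have h0 : N.choose h = ((Finset.univ : Finset (Fin N)).powersetCard h).card := by simp
  rw [h0]
  refine Finset.card_bij (fun x _ => Finset.univ.filter fun k => x k = 0) ?_ ?_ ?_
  · intro x hx
    rw [Finset.mem_powersetCard]
    exact ⟨Finset.subset_univ _, (Finset.mem_filter.1 hx).2⟩
  · intro x _ y _ hxy
    funext k
    have hk : x k = 0 ↔ y k = 0 := by simpa using Finset.ext_iff.1 hxy k
    generalize x k = u at hk ⊢
    generalize y k = v at hk ⊢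
    revert hk
    fin_cases u <;> fin_cases v <;> simp
  · intro s hs
    have hfil : (Finset.univ.filter fun k => (if k ∈ s then (0 : Fin 2) else 1) = 0) = s := by
      ext k; by_cases hk : k ∈ s <;> simp [hk]
    refine ⟨fun k => if k ∈ s then 0 else 1, ?_, hfil⟩
    rw [Finset.mem_filter]
    refine ⟨Finset.mem_univ _, ?_⟩
    rw [numUp, hfil]
    exact (Finset.mem_powersetCard.1 hs).2

theorem rotMatrix_two (θ : ℝ) : rotMatrix 2 θ = Matrix.diagonal
    ![(Real.cos (θ / 2) : ℂ) - Complex.I * (Real.sin (θ / 2) : ℂ),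
      (Real.cos (θ / 2) : ℂ) + Complex.I * (Real.sin (θ / 2) : ℂ)] := by
  ext i j
  fin_cases i <;> fin_cases j <;> simp [rotMatrix, pauli]

/-- The rotation about z is diagonal with entries a^h b^(N - h), where h spins are up and a, b have
derivatives -i/2, i/2 at θ = 0. -/
theorem generator_two_qubits (N : ℕ) : generator (qubitsRep N) 2
    = Matrix.diagonal fun x => (((numUp x : ℝ) - N / 2 : ℝ) : ℂ) := by
  have hrep : ∀ θ, qubitsRep N (rot 2 θ) = Matrix.diagonal fun x => ∏ k,
      (![(Real.cos (θ / 2) : ℂ) - Complex.I * (Real.sin (θ / 2) : ℂ),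
      (Real.cos (θ / 2) : ℂ) + Complex.I * (Real.sin (θ / 2) : ℂ)] : Fin 2 → ℂ) (x k) := by
    intro θ
    rw [← tensorPow_diagonal, ← rotMatrix_two]; rfl
  have h1 : HasDerivAt (fun θ : ℝ => θ / 2) (1 / 2) 0 := (hasDerivAt_id (0 : ℝ)).div_const 2
  have hc : HasDerivAt (fun θ : ℝ => ((Real.cos (θ / 2) : ℝ) : ℂ)) 0 0 := by
    have := (h1.cos).ofReal_comp
    simpa using this
  have hs : HasDerivAt (fun θ : ℝ => ((Real.sin (θ / 2) : ℝ) : ℂ)) (1 / 2) 0 := by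
    have := (h1.sin).ofReal_comp
    simpa using this
  ext x y
  simp only [generator, Matrix.of_apply, hrep]
  rcases eq_or_ne x y with rfl | hxy
  · simp only [Matrix.diagonal_apply_eq, prod_eq_numUp]
    have hd := ((hc.sub (hs.const_mul Complex.I)).pow (numUp x)).mul
      ((hc.add (hs.const_mul Complex.I)).pow (N - numUp x))
    have hd' := hd.deriv
    simp only [Pi.sub_apply, Pi.add_apply, Pi.pow_apply, zero_div, Real.cos_zero,
      Real.sin_zero, Complex.ofReal_one, Complex.ofReal_zero, mul_zero, sub_zero, add_zero,
      one_pow, mul_one, one_mul, zero_sub, zero_add] at hd'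
    refine (congrArg (Complex.I * ·) hd').trans ?_
    rw [Nat.cast_sub (numUp_le x)]
    push_cast
    linear_combination (-(numUp x : ℂ) + N / 2) * Complex.I_mul_I
  · simp [Matrix.diagonal_apply_ne _ hxy]

theorem eigenProj_diagonal {m : Type*} [Fintype m] [DecidableEq m] (d : m → ℝ) (l : ℝ) :
    eigenProj (Matrix.diagonal fun x => (d x : ℂ)) l
      = Matrix.diagonal fun x => if d x = l then 1 else 0 := by
  apply eq_eigenProj
  · rw [Matrix.IsHermitian, Matrix.diagonal_conjTranspose]
    congr 1
    funext x
    by_cases hx : d x = l <;> simp [hx]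
  · rw [Matrix.diagonal_mul_diagonal, ← Matrix.diagonal_smul]
    congr 1
    funext x
    by_cases hx : d x = l <;> simp [hx]
  · intro Y hY
    ext x y
    have h := congrFun (congrFun hY x) y
    rw [Matrix.diagonal_mul, Matrix.smul_apply, smul_eq_mul] at h
    rw [Matrix.diagonal_mul]
    by_cases hx : d x = l
    · simp [hx]
    · have h2 : ((d x : ℂ) - l) * Y x y = 0 := by rw [sub_mul, h, sub_self]
      have h3 : (d x : ℂ) - l ≠ 0 := sub_ne_zero.2 (by exact_mod_cast hx)
      rw [(mul_eq_zero.1 h2).resolve_left h3, mul_zero]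

theorem eigenProj_generator_two (N h : ℕ) :
    eigenProj (generator (qubitsRep N) 2) (h - N / 2)
      = Matrix.diagonal fun x => if numUp x = h then 1 else 0 := by
  rw [generator_two_qubits, eigenProj_diagonal]
  congr 1
  funext x
  simp

theorem trace_eigenProj_generator_two (N h : ℕ) :
    (eigenProj (generator (qubitsRep N) 2) (h - N / 2)).trace = N.choose h := by
  rw [eigenProj_generator_two, Matrix.trace_diagonal, Finset.sum_boole, card_numUp_eq]

theorem tensorPow_diagonal_eq_sum (N : ℕ) (p : ℝ) :
    tensorPow N (Matrix.diagonal ![(p : ℂ), ((1 - p : ℝ) : ℂ)])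
      = ∑ h ∈ Finset.range (N + 1), ((p ^ h * (1 - p) ^ (N - h) : ℝ) : ℂ) •
        eigenProj (generator (qubitsRep N) 2) (h - N / 2) := by
  simp only [eigenProj_generator_two, ← Matrix.diagonal_smul]
  rw [tensorPow_diagonal]
  ext x y
  rw [Matrix.sum_apply]
  rcases eq_or_ne x y with rfl | hxy
  · simp only [Matrix.diagonal_apply_eq, prod_eq_numUp, Pi.smul_apply, smul_eq_mul, mul_ite,
      mul_one, mul_zero]
    rw [Finset.sum_ite_eq, if_pos (Finset.mem_range.2 (Nat.lt_succ_of_le (numUp_le x)))]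
    push_cast
    rfl
  · simp [Matrix.diagonal_apply_ne _ hxy]

end Basis

/-! ### Bloch vectors -/

section Bloch

theorem qubitState_eq (p : ℝ) (n : EuclideanSpace ℝ (Fin 3)) :
    qubitState p n = (1 / 2 : ℂ) • (1 : Matrix (Fin 2) (Fin 2) ℂ)
      + ((2 * p - 1 : ℝ) / 2 : ℂ) • ∑ a, (n a : ℂ) • pauli a := by
  simp only [qubitState, blochProj, PiLp.neg_apply, Complex.ofReal_neg, neg_smul,
    Finset.sum_neg_distrib]
  generalize ∑ a, (n a : ℂ) • pauli a = X
  push_cast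
  module

/-- Spherical coordinates, with the azimuth taken as a complex argument; at the poles the modulus
vanishes and any argument serves. -/
theorem exists_angles (n : BlochSphere) : ∃ θ φ : ℝ,
    n.1 0 = Real.sin θ * Real.cos φ ∧ n.1 1 = Real.sin θ * Real.sin φ ∧ n.1 2 = Real.cos θ := by
  have hn : ‖n.1‖ = 1 := by simp
  have hsum : n.1 0 ^ 2 + n.1 1 ^ 2 + n.1 2 ^ 2 = 1 := by
    have h := EuclideanSpace.norm_sq_eq n.1
    rw [hn, Fin.sum_univ_three] at h
    simpa using h.symm
  set z : ℂ := ⟨n.1 0, n.1 1⟩ with hz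
  have hsin : Real.sin (Real.arccos (n.1 2)) = ‖z‖ := by
    rw [Real.sin_arccos, Complex.norm_eq_sqrt_sq_add_sq]
    congr 1
    linarith
  refine ⟨Real.arccos (n.1 2), z.arg, ?_, ?_, ?_⟩
  · rw [hsin, Complex.norm_mul_cos_arg]
  · rw [hsin, Complex.norm_mul_sin_arg]
  · rw [Real.cos_arccos] <;> nlinarith [sq_nonneg (n.1 0), sq_nonneg (n.1 1)]

theorem rotMatrix_conjTranspose (a : Fin 3) (θ : ℝ) :
    (rotMatrix a θ)ᴴ = rotMatrix a (-θ) := by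
  have h := congrArg Subtype.val (rot_neg a θ)
  exact h.symm

theorem rotMatrix_mul_neg (a : Fin 3) (θ : ℝ) : rotMatrix a θ * rotMatrix a (-θ) = 1 := by
  have h := congrArg Subtype.val (rot_add a θ (-θ))
  rw [add_neg_cancel, rot_zero] at h
  exact h.symm

theorem rotMatrix_two_conj_pauli_two (φ : ℝ) :
    rotMatrix 2 φ * pauli 2 * rotMatrix 2 (-φ) = pauli 2 := by
  have hc : rotMatrix 2 φ * pauli 2 = pauli 2 * rotMatrix 2 φ := by
    simp only [rotMatrix, Matrix.sub_mul, Matrix.mul_sub, Matrix.smul_mul, Matrix.mul_smul,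
      one_mul, mul_one]
  rw [hc, mul_assoc, rotMatrix_mul_neg, mul_one]

/-- Every mixed qubit state is obtained by rotating the one along the `z` axis. -/
theorem exists_rot_qubitState (p : ℝ) (n : BlochSphere) : ∃ θ φ : ℝ,
    qubitState p n = (rot 2 φ * rot 1 θ : SU2).1
      * Matrix.diagonal ![(p : ℂ), ((1 - p : ℝ) : ℂ)] * ((rot 2 φ * rot 1 θ : SU2).1)ᴴ := by
  obtain ⟨θ, φ, h0, h1, h2⟩ := exists_angles n
  refine ⟨θ, φ, ?_⟩
  have hD : Matrix.diagonal ![(p : ℂ), ((1 - p : ℝ) : ℂ)]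
      = (1 / 2 : ℂ) • (1 : Matrix (Fin 2) (Fin 2) ℂ) + ((2 * p - 1 : ℝ) / 2 : ℂ) • pauli 2 := by
    ext i j
    fin_cases i <;> fin_cases j <;> simp [pauli] <;> ring
  have hval : (rot 2 φ * rot 1 θ : SU2).1 = rotMatrix 2 φ * rotMatrix 1 θ := rfl
  have hs : rotMatrix 2 φ * rotMatrix 1 θ * pauli 2 * (rotMatrix 1 (-θ) * rotMatrix 2 (-φ))
      = ∑ a, (n.1 a : ℂ) • pauli a := by
    have e1 := rot_conj_tangent 2 θ
    have e2 := rot_conj_tangent 0 φ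
    simp only [Fin.isValue, zero_add, show (2 : Fin 3) + 2 = 1 from rfl,
      show (2 : Fin 3) + 1 = 0 from rfl] at e1 e2
    calc _ = rotMatrix 2 φ * (rotMatrix 1 θ * pauli 2 * rotMatrix 1 (-θ)) * rotMatrix 2 (-φ) := by
          simp only [mul_assoc]
      _ = _ := by
          rw [e1, Matrix.mul_add, Matrix.add_mul, Matrix.mul_smul, Matrix.mul_smul,
            Matrix.smul_mul, Matrix.smul_mul, rotMatrix_two_conj_pauli_two, e2,
            Fin.sum_univ_three, h0, h1, h2]
          push_cast
          module
  have hone : rotMatrix 2 φ * rotMatrix 1 θ * (rotMatrix 1 (-θ) * rotMatrix 2 (-φ)) = 1 := by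
    rw [mul_assoc, ← mul_assoc (rotMatrix 1 θ), rotMatrix_mul_neg, one_mul, rotMatrix_mul_neg]
  rw [qubitState_eq, hD, hval, conjTranspose_mul, rotMatrix_conjTranspose,
    rotMatrix_conjTranspose, Matrix.mul_add, Matrix.add_mul, Matrix.mul_smul, Matrix.mul_smul,
    Matrix.smul_mul, Matrix.smul_mul, mul_one, hone, hs]

theorem isState_tensorPow_qubitState {p : ℝ} (hp0 : 0 ≤ p) (hp1 : p ≤ 1) (N : ℕ)
    (n : BlochSphere) : IsState (tensorPow N (qubitState p n)) := by
  obtain ⟨θ, φ, h⟩ := exists_rot_qubitState p n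
  have hU := (qubitsHom N (rot 2 φ * rot 1 θ)).2
  have hq : 0 ≤ 1 - p := by linarith
  rw [h, tensorPow_mul, tensorPow_mul, tensorPow_conjTranspose]
  constructor
  · refine Matrix.PosSemidef.mul_mul_conjTranspose_same ?_ _
    rw [tensorPow_diagonal]
    refine Matrix.PosSemidef.diagonal fun x => ?_
    rw [prod_eq_numUp]
    change (0 : ℂ) ≤ _
    have : (0 : ℝ) ≤ p ^ numUp x * (1 - p) ^ (N - numUp x) := by positivity
    exact_mod_cast this
  · rw [trace_mul_comm, ← mul_assoc]
    have : (tensorPow N (rot 2 φ * rot 1 θ : SU2).1)ᴴ * tensorPow N (rot 2 φ * rot 1 θ : SU2).1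
        = 1 := Matrix.mem_unitaryGroup_iff'.1 hU
    rw [this, one_mul, tensorPow_diagonal_eq_sum, trace_sum]
    have hs := sum_binomialMass (p := p) N
    have hs' := congrArg (Complex.ofReal) hs
    rw [Complex.ofReal_sum, Complex.ofReal_one] at hs'
    rw [← hs']
    refine Finset.sum_congr rfl fun k _ => ?_
    rw [trace_smul, trace_eigenProj_generator_two, binomialMass, smul_eq_mul]
    push_cast
    ring

/-- The distribution of the squared angular momentum in terms of weight multiplicities. -/
theorem trace_eigenProj_mul_tensorPow (p : ℝ) (N : ℕ) (n : BlochSphere) (l : ℝ) :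
    (eigenProj (angMomSq (qubitsRep N)) l * tensorPow N (qubitState p n)).trace
      = ∑ h ∈ Finset.range (N + 1), ((p ^ h * (1 - p) ^ (N - h) : ℝ) : ℂ) *
        weightMult (generator (qubitsRep N)) l (h - N / 2) := by
  obtain ⟨θ, φ, h⟩ := exists_rot_qubitState p n
  have hU := (qubitsHom N (rot 2 φ * rot 1 θ)).2
  -- The rotation to the z axis commutes with `J²` and cancels under the trace, so the sector
  -- distribution does not depend on the Bloch vector.
  have hc : Commute (angMomSq (qubitsRep N)) (tensorPow N (rot 2 φ * rot 1 θ : SU2).1) := by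
    have hc1 := (angMomSq_commute_rep_rot (qubitsHom N) (continuous_qubitsHom N) 2 φ).mul_right
      (angMomSq_commute_rep_rot (qubitsHom N) (continuous_qubitsHom N) 1 θ)
    have hm : tensorPow N (rot 2 φ * rot 1 θ : SU2).1
        = (qubitsHom N (rot 2 φ) : Matrix _ _ ℂ) * (qubitsHom N (rot 1 θ) : Matrix _ _ ℂ) :=
      tensorPow_mul _ _ _
    rw [hm]
    exact hc1
  have hcP := eigenProj_commute (isAngMom_qubits N).sq_isHermitian hc l
  have hinv : (tensorPow N (rot 2 φ * rot 1 θ : SU2).1)ᴴ * tensorPow N (rot 2 φ * rot 1 θ : SU2).1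
        = 1 := Matrix.mem_unitaryGroup_iff'.1 hU
  rw [h, tensorPow_mul, tensorPow_mul, tensorPow_conjTranspose, ← mul_assoc, ← mul_assoc]
  have hcP' : eigenProj (angMomSq (qubitsRep N)) l * tensorPow N (rot 2 φ * rot 1 θ : SU2).1
      = tensorPow N (rot 2 φ * rot 1 θ : SU2).1 * eigenProj (angMomSq (qubitsRep N)) l := hcP.eq
  rw [hcP', trace_mul_comm, ← mul_assoc, ← mul_assoc, hinv, one_mul,
    tensorPow_diagonal_eq_sum, Finset.mul_sum, trace_sum]
  refine Finset.sum_congr rfl fun k _ => ?_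
  rw [Matrix.mul_smul, trace_smul, smul_eq_mul]
  rfl

end Bloch

/-! ### The distribution of the total angular momentum -/

section Distribution

variable {p : ℝ}

theorem sectorProb_eq (p : ℝ) (N : ℕ) (n : BlochSphere) (l : ℝ) :
    (eigenProj (angMomSq (qubitsRep N)) l * tensorPow N (qubitState p n)).trace.re
      = ∑ h ∈ Finset.range (N + 1), p ^ h * (1 - p) ^ (N - h) *
        (weightMult (generator (qubitsRep N)) l (h - N / 2)).re := by
  rw [trace_eigenProj_mul_tensorPow, Complex.re_sum]
  exact Finset.sum_congr rfl fun h _ => Complex.re_ofReal_mul _ _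

theorem sum_weightMult_le (N h : ℕ) (L : Finset ℝ) :
    ∑ l ∈ L, (weightMult (generator (qubitsRep N)) l (h - N / 2)).re ≤ N.choose h := by
  have hJ := isAngMom_qubits N
  calc _ = ∑ l ∈ L.filter (· ∈ eigenvalueSet hJ.sq_isHermitian),
        (weightMult (generator (qubitsRep N)) l (h - N / 2)).re := by
        rw [Finset.sum_filter]
        refine Finset.sum_congr rfl fun l _ => ?_
        split_ifs with hl
        · rfl
        · rw [weightMult, eigenProj_eq_zero_of_notMem hJ.sq_isHermitian hl]; simp
    _ ≤ ∑ l ∈ eigenvalueSet hJ.sq_isHermitian,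
        (weightMult (generator (qubitsRep N)) l (h - N / 2)).re :=
        Finset.sum_le_sum_of_subset_of_nonneg
          (fun l hl => (Finset.mem_filter.1 hl).2) fun l _ _ => hJ.weightMult_nonneg _ _
    _ = N.choose h := by
        rw [← Complex.re_sum, hJ.sum_weightMult_right, trace_eigenProj_generator_two]
        simp

/-- The probability of a single value of the total angular momentum is of order `1 / √N`. -/
theorem sectorProb_le (hp : 1 / 2 < p) (hp1 : p < 1) {N : ℕ} (hN : 0 < N) (n : BlochSphere)
    (l : ℝ) : (eigenProj (angMomSq (qubitsRep N)) l * tensorPow N (qubitState p n)).trace.re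
      ≤ p / (2 * p - 1) * (8 / √(N * p * (1 - p))) := by
  have hJ := isAngMom_qubits N
  have hp0 : 0 < p := by linarith
  have hq : 0 < 1 - p := by linarith
  have hB : 0 ≤ p / (2 * p - 1) * (8 / √(N * p * (1 - p))) := by
    have : 0 < 2 * p - 1 := by linarith
    positivity
  rw [sectorProb_eq]
  set a : ℕ → ℝ := fun h => (weightMult (generator (qubitsRep N)) l (h - N / 2)).re with ha
  have ha0 : ∀ h : ℕ, weightMult (generator (qubitsRep N)) l (h - N / 2) = 0 → a h = 0 := by
    intro h h0; simp [ha, h0]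
  by_cases hall : ∀ h : ℕ, weightMult (generator (qubitsRep N)) l (h - N / 2) = 0
  · rw [Finset.sum_eq_zero fun h _ => by rw [hall h]; simp]
    exact hB
  push Not at hall
  obtain ⟨h1, hh1⟩ := hall
  obtain ⟨k, -, hk, -, -, -, -⟩ := hJ.weightMult_string hh1
  -- Number of up spins at the top weight j of the sector; j depends on l alone, so every string of
  -- the sector ends here.
  set h0 := h1 + k with hh0
  have hj : (h0 : ℝ) - N / 2 = (√(1 + 4 * l) - 1) / 2 := by
    rw [← hk, hh0]; push_cast; ring
  have hle : ∀ h, a h ≤ a h0 ∧ (h0 < h → a h = 0) := by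
    intro h
    by_cases hz : weightMult (generator (qubitsRep N)) l (h - N / 2) = 0
    · rw [ha0 h hz]
      exact ⟨hJ.weightMult_nonneg _ _, fun _ => rfl⟩
    · obtain ⟨k', -, hk', -, -, hc, -⟩ := hJ.weightMult_string hz
      have hhk : h + k' = h0 := by
        have : ((h + k' : ℕ) : ℝ) = h0 := by push_cast; linarith
        exact_mod_cast this
      refine ⟨le_of_eq ?_, fun hlt => by omega⟩
      have := hc k' le_rfl
      rw [hk', ← hj] at this
      simp only [ha, this]
  have hch : a h0 ≤ N.choose h0 := by
    have := sum_weightMult_le N h0 {l}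
    simpa using this
  set r := (1 - p) / p with hr
  have hr0 : 0 ≤ r := by positivity
  have hr1 : r < 1 := by rw [hr, div_lt_one hp0]; linarith
  rcases lt_or_ge N h0 with hNh | hNh
  · have hz : a h0 ≤ 0 := by rwa [Nat.choose_eq_zero_of_lt hNh, Nat.cast_zero] at hch
    refine le_trans (Finset.sum_nonpos fun h _ => ?_) hB
    exact mul_nonpos_of_nonneg_of_nonpos (by positivity) ((hle h).1.trans hz)
  -- Lowering the weight by one multiplies the state's eigenvalue by r = (1 - p)/p < 1, while the
  -- multiplicity stays at most that of the top weight, hence at most `N.choose h0`.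
  have hterm : ∀ h ≤ h0, p ^ h * (1 - p) ^ (N - h) * a h ≤ binomialMass N p h0 * r ^ (h0 - h) := by
    intro h hh
    have e1 : p ^ h * (1 - p) ^ (N - h) = p ^ h0 * (1 - p) ^ (N - h0) * r ^ (h0 - h) := by
      have e2 : N - h = (N - h0) + (h0 - h) := by omega
      have e3 : p ^ h0 = p ^ h * p ^ (h0 - h) := by rw [← pow_add]; congr 1; omega
      rw [e2, e3, pow_add, hr, div_pow]
      field_simp
    rw [e1, binomialMass]
    calc _ ≤ p ^ h0 * (1 - p) ^ (N - h0) * r ^ (h0 - h) * N.choose h0 :=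
          mul_le_mul_of_nonneg_left ((hle h).1.trans hch) (by positivity)
      _ = _ := by ring
  have hb0 := binomialMass_nonneg hp0.le hp1.le N h0
  calc ∑ h ∈ Finset.range (N + 1), p ^ h * (1 - p) ^ (N - h) * a h
      = ∑ h ∈ Finset.range (h0 + 1), p ^ h * (1 - p) ^ (N - h) * a h := by
        symm
        refine Finset.sum_subset (fun h hh => ?_) fun h _ hh => ?_
        · rw [Finset.mem_range] at hh ⊢; omega
        · rw [Finset.mem_range] at hh
          rw [(hle h).2 (by omega), mul_zero]
    _ ≤ ∑ h ∈ Finset.range (h0 + 1), binomialMass N p h0 * r ^ (h0 - h) :=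
        Finset.sum_le_sum fun h hh => hterm h (by rw [Finset.mem_range] at hh; omega)
    _ = binomialMass N p h0 * ∑ i ∈ Finset.range (h0 + 1), r ^ i := by
        rw [← Finset.mul_sum, ← Finset.sum_range_reflect (fun i => r ^ i)]
        congr 1
    _ ≤ binomialMass N p h0 * (p / (2 * p - 1)) := by
        refine mul_le_mul_of_nonneg_left ?_ hb0
        have h1 : 1 - r = (2 * p - 1) / p := by rw [hr]; field_simp; ring
        have h2 := mul_neg_geom_sum r (h0 + 1)
        rw [← inv_div, ← h1, inv_eq_one_div, le_div_iff₀ (by linarith), mul_comm, h2]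
        linarith [pow_nonneg hr0 (h0 + 1)]
    _ ≤ _ := by
        rw [mul_comm]
        exact mul_le_mul_of_nonneg_left (binomialMass_le hp0 hp1 hN h0)
          (div_nonneg hp0.le (by linarith))

/-- Small values of the total angular momentum are unlikely. -/
theorem sum_sectorProb_small_le (hp0 : 0 ≤ p) (hp1 : p ≤ 1) {N : ℕ} (n : BlochSphere)
    (L : Finset ℝ) {s : ℝ} (hs : 0 ≤ s) (hL : ∀ l ∈ L, l < s ^ 2) (hsN : s < N * p - N / 2) :
    ∑ l ∈ L, (eigenProj (angMomSq (qubitsRep N)) l * tensorPow N (qubitState p n)).trace.re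
      ≤ N * p * (1 - p) / (N * p - N / 2 - s) ^ 2 := by
  have hJ := isAngMom_qubits N
  have hq : 0 ≤ 1 - p := by linarith
  refine le_trans ?_ (sum_binomialMass_tail_le hp0 hp1 (N := N) (sub_pos.2 hsN))
  simp only [sectorProb_eq]
  rw [Finset.sum_comm, Finset.sum_filter]
  refine Finset.sum_le_sum fun h _ => ?_
  rw [← Finset.mul_sum]
  split_ifs with hh
  · rw [binomialMass, mul_comm]
    exact mul_le_mul_of_nonneg_right (sum_weightMult_le N h L) (by positivity)
  · rw [Finset.sum_eq_zero, mul_zero]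
    intro l hl
    by_contra hne
    have hne' : weightMult (generator (qubitsRep N)) l (h - N / 2) ≠ 0 := fun h0 =>
      hne (by rw [h0]; rfl)
    obtain ⟨k, m, hk, -, hkm, -, -⟩ := hJ.weightMult_string hne'
    -- Thus j ≤ s, so every weight h - N/2 of the sector is at most s and h lies in the lower
    -- binomial tail.
    have h1 : √(1 + 4 * l) ≤ 1 + 2 * s := by
      refine Real.sqrt_le_iff.2 ⟨by linarith, ?_⟩
      nlinarith [hL l hl]
    have hk0 : (0 : ℝ) ≤ k := Nat.cast_nonneg k
    refine hh ?_
    linarith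

theorem sum_sectorProb_le (hp : 1 / 2 < p) (hp1 : p < 1) {N : ℕ} (hN : 0 < N) (n : BlochSphere)
    (L : Finset ℝ) {s : ℝ} (hs : 0 ≤ s) (hsN : s < N * p - N / 2) :
    ∑ l ∈ L, (eigenProj (angMomSq (qubitsRep N)) l * tensorPow N (qubitState p n)).trace.re
      ≤ (L.filter (fun l => s ^ 2 ≤ l)).card * (p / (2 * p - 1) * (8 / √(N * p * (1 - p))))
        + N * p * (1 - p) / (N * p - N / 2 - s) ^ 2 := by
  rw [← Finset.sum_filter_add_sum_filter_not L (fun l => s ^ 2 ≤ l)]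
  refine add_le_add ?_ (sum_sectorProb_small_le (by linarith) hp1.le n _ hs ?_ hsN)
  · rw [← nsmul_eq_mul]
    exact Finset.sum_le_card_nsmul _ _ _ fun l _ => sectorProb_le hp hp1 hN n l
  · intro l hl
    exact not_le.1 (Finset.mem_filter.1 hl).2

end Distribution

/-! ### The trace norm -/

section TraceNorm

variable {m : Type*} [Fintype m] [DecidableEq m]

omit [DecidableEq m] in
theorem conjTranspose_mul_self_apply_self (X : Matrix m m ℂ) (i : m) :
    (Xᴴ * X) i i = ((∑ j, ‖X j i‖ ^ 2 : ℝ) : ℂ) := by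
  rw [Matrix.mul_apply, Complex.ofReal_sum]
  refine Finset.sum_congr rfl fun j _ => ?_
  rw [conjTranspose_apply, Complex.star_def, Complex.conj_mul', Complex.ofReal_pow]

omit [DecidableEq m] in
theorem norm_conjTranspose_mul_apply_le (X Y : Matrix m m ℂ) (i : m) :
    ‖(Xᴴ * Y) i i‖ ≤ √((Xᴴ * X) i i).re * √((Yᴴ * Y) i i).re := by
  rw [conjTranspose_mul_self_apply_self, conjTranspose_mul_self_apply_self, Complex.ofReal_re,
    Complex.ofReal_re]
  refine le_trans ?_ (Real.sum_mul_le_sqrt_mul_sqrt Finset.univ (fun j => ‖X j i‖)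
    (fun j => ‖Y j i‖))
  rw [Matrix.mul_apply]
  refine (norm_sum_le _ _).trans (le_of_eq ?_)
  refine Finset.sum_congr rfl fun j _ => ?_
  rw [conjTranspose_apply, norm_mul, norm_star]

/-- The trace norm dominates the expectation of any unitary. -/
theorem norm_trace_mul_le_traceNorm (A : Matrix m m ℂ) {W : Matrix m m ℂ}
    (hW : W ∈ Matrix.unitaryGroup m ℂ) : ‖(W * A).trace‖ ≤ traceNorm A := by
  have hA := isHermitian_conjTranspose_mul_self A
  change _ ≤ ∑ i, √(hA.eigenvalues i)
  set U : Matrix m m ℂ := hA.eigenvectorUnitary.1 with hU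
  have hUU : U * Uᴴ = 1 := Matrix.mem_unitaryGroup_iff.1 hA.eigenvectorUnitary.2
  have hUU' : Uᴴ * U = 1 := Matrix.mem_unitaryGroup_iff'.1 hA.eigenvectorUnitary.2
  have hWW : Wᴴ * W = 1 := Matrix.mem_unitaryGroup_iff'.1 hW
  have hspec : Uᴴ * (Aᴴ * A) * U = Matrix.diagonal fun i => (hA.eigenvalues i : ℂ) := by
    have h := hA.conjStarAlgAut_star_eigenvectorUnitary
    rw [Unitary.conjStarAlgAut_star_apply] at h
    exact h
  -- In the eigenbasis of AᴴA the i-th diagonal entry of W A is at most the norm of W A uᵢ, which is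
  -- that of A uᵢ, the i-th singular value.
  have h1 : (W * A).trace = ∑ i, (Uᴴ * (W * A * U)) i i := by
    change _ = (Uᴴ * (W * A * U)).trace
    rw [trace_mul_comm Uᴴ, mul_assoc, hUU, mul_one]
  rw [h1]
  refine (norm_sum_le _ _).trans (Finset.sum_le_sum fun i _ => ?_)
  refine (norm_conjTranspose_mul_apply_le _ _ i).trans (le_of_eq ?_)
  have h2 : (W * A * U)ᴴ * (W * A * U) = Uᴴ * (Aᴴ * A) * U := by
    rw [conjTranspose_mul, conjTranspose_mul]
    calc _ = Uᴴ * (Aᴴ * ((Wᴴ * W) * A)) * U := by simp only [mul_assoc]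
      _ = _ := by rw [hWW, one_mul]
  rw [h2, hspec, hUU']
  simp

open scoped Matrix.Norms.L2Operator in
-- Expressing the norm as tr √(AᴴA) through the functional calculus avoids following individual
-- eigenvalues. Continuity is what makes the error integrable.
theorem continuous_traceNorm : Continuous (traceNorm : Matrix m m ℂ → ℝ) := by
  have h1 : (traceNorm : Matrix m m ℂ → ℝ) = fun A => (cfc Real.sqrt (Aᴴ * A)).trace.re := by
    funext A
    rw [(isHermitian_conjTranspose_mul_self A).cfc_eq, IsHermitian.cfc,
      Unitary.conjStarAlgAut_apply, trace_mul_comm, ← mul_assoc,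
      Unitary.star_mul_self_of_mem (isHermitian_conjTranspose_mul_self A).eigenvectorUnitary.2,
      one_mul, Matrix.trace_diagonal, Complex.re_sum, traceNorm]
    rfl
  rw [h1]
  refine Complex.continuous_re.comp (Continuous.matrix_trace ?_)
  refine Continuous.cfc_of_mem_nhdsSet (s := Set.univ) Real.sqrt Filter.univ_mem ?_
    (fun A => isHermitian_conjTranspose_mul_self A) Real.continuous_sqrt.continuousOn
  exact continuous_id.matrix_conjTranspose.matrix_mul continuous_id

end TraceNorm

/-! ### Lower bound on the error -/

section ErrorBound

variable {m : Type*} [Fintype m] [DecidableEq m]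

/-- The unitary 1 - 2P is the test: its expectation on ρ - σ is 2(tr Pσ - tr Pρ), since the traces
agree. -/
theorem one_sub_le_traceNorm_half {ρ σ P : Matrix m m ℂ} (hP : P.IsHermitian) (hPP : P * P = P)
    (htr : ρ.trace = σ.trace) {η : ℝ} (hσ : (P * σ).trace.re = 1) (hρ : (P * ρ).trace.re ≤ η) :
    1 - η ≤ traceNorm (ρ - σ) / 2 := by
  have hW : (1 - (2 : ℂ) • P) ∈ Matrix.unitaryGroup m ℂ := by
    rw [Matrix.mem_unitaryGroup_iff, Matrix.star_eq_conjTranspose, conjTranspose_sub,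
      conjTranspose_one, conjTranspose_smul, hP.eq]
    simp only [Matrix.sub_mul, Matrix.mul_sub, Matrix.smul_mul, Matrix.mul_smul, hPP, one_mul,
      mul_one, Complex.star_def, map_ofNat]
    module
  have h := norm_trace_mul_le_traceNorm (ρ - σ) hW
  have h2 := (Complex.re_le_norm _).trans h
  rw [Matrix.sub_mul, one_mul, Matrix.smul_mul, trace_sub, trace_sub, htr, sub_self, zero_sub,
    trace_smul, Matrix.mul_sub, trace_sub, smul_eq_mul] at h2
  simp only [Complex.neg_re, Complex.mul_re, Complex.re_ofNat, Complex.im_ofNat, zero_mul,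
    sub_zero, Complex.sub_re] at h2
  linarith

theorem isHermitian_sum_eigenProj (H : Matrix m m ℂ) (L : Finset ℝ) :
    (∑ l ∈ L, eigenProj H l).IsHermitian := by
  rw [Matrix.IsHermitian, conjTranspose_sum]
  exact Finset.sum_congr rfl fun l _ => (eigenProj_isHermitian H l).eq

theorem sum_eigenProj_mul_self {H : Matrix m m ℂ} (hH : H.IsHermitian) (L : Finset ℝ) :
    (∑ l ∈ L, eigenProj H l) * (∑ l ∈ L, eigenProj H l) = ∑ l ∈ L, eigenProj H l := by
  rw [Finset.sum_mul]
  refine Finset.sum_congr rfl fun l hl => ?_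
  rw [Finset.mul_sum, Finset.sum_eq_single l, eigenProj_mul_self]
  · exact fun l' _ hne => eigenProj_mul_eigenProj_of_ne hH hne.symm
  · exact fun h => absurd hl h

theorem IsChannel.isState {k n : Type*} [Fintype k] [Fintype n]
    {Φ : Matrix k k ℂ →ₗ[ℂ] Matrix n n ℂ} (hΦ : IsChannel Φ) {ρ : Matrix k k ℂ}
    (hρ : IsState ρ) : IsState (Φ ρ) := by
  refine ⟨?_, by rw [hΦ.tracePreserving, hρ.2]⟩
  -- Positivity is complete positivity with a one-dimensional ancilla.
  have h := hΦ.completelyPositive 1 (ρ.submatrix Prod.fst Prod.fst) (hρ.1.submatrix _)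
  exact h.submatrix fun i => (i, (0 : Fin 1))

variable {p : ℝ} {N d : ℕ}

/-- A decoder that preserves the magnitude of the angular momentum only reaches the few sectors
that occur in the encoding system, and the input states rarely lie in these. -/
theorem le_error (hp : 1 / 2 < p) (hp1 : p < 1) (hN : 0 < N)
    {V : SU2 →* Matrix.unitaryGroup (Fin d) ℂ} (hV : Continuous V)
    {E : Matrix (Fin N → Fin 2) (Fin N → Fin 2) ℂ →ₗ[ℂ] Matrix (Fin d) (Fin d) ℂ}
    {D : Matrix (Fin d) (Fin d) ℂ →ₗ[ℂ] Matrix (Fin N → Fin 2) (Fin N → Fin 2) ℂ}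
    (hE : IsChannel E) (hD : IsChannel D) (hDV : PreservesAngMomMagnitude V D)
    {s : ℝ} (hs : 0 < s) (hsN : s < N * p - N / 2) (n : BlochSphere) :
    1 - (d / (2 * s) * (p / (2 * p - 1) * (8 / √(N * p * (1 - p))))
        + N * p * (1 - p) / (N * p - N / 2 - s) ^ 2)
      ≤ traceNorm (tensorPow N (qubitState p n) - D (E (tensorPow N (qubitState p n)))) / 2 := by
  have hJ := isAngMom_qubits N
  have hK := isAngMom_generator V hV
  have hρ := isState_tensorPow_qubitState (by linarith : 0 ≤ p) hp1.le N n
  set ρ := tensorPow N (qubitState p n) with hρdef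
  have hEρ := hE.isState hρ
  have hDρ := hD.isState hEρ
  set S := eigenvalueSet hK.sq_isHermitian with hS
  -- The test projector lives on the qubits but is indexed by the spectrum of `K²`. Magnitude
  -- preservation turns its expectation on the output into the trace of the encoded state against
  -- the full resolution of the identity, which is 1.
  refine one_sub_le_traceNorm_half (isHermitian_sum_eigenProj (angMomSq (qubitsRep N)) S)
    (sum_eigenProj_mul_self hJ.sq_isHermitian S) (by rw [hρ.2, hDρ.2]) ?_ ?_
  · rw [Finset.sum_mul, trace_sum, Finset.sum_congr rfl fun l _ => hDV _ hEρ l, ← trace_sum,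
      ← Finset.sum_mul]
    have := sum_eigenProj hK.sq_isHermitian
    change (∑ l ∈ S, eigenProj (angMomSq fun g => (V g : Matrix (Fin d) (Fin d) ℂ)) l) = 1 at this
    rw [this, one_mul, hEρ.2, Complex.one_re]
  · rw [Finset.sum_mul, trace_sum, Complex.re_sum]
    refine (sum_sectorProb_le hp hp1 hN n S hs.le hsN).trans (add_le_add_left ?_ _)
    have hB : 0 ≤ p / (2 * p - 1) * (8 / √(N * p * (1 - p))) := by
      have : 0 < 2 * p - 1 := by linarith
      positivity
    refine mul_le_mul_of_nonneg_right ?_ hB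
    rw [le_div_iff₀ (by positivity)]
    simpa using hK.card_mul_le (s := s)

theorem continuous_qubitState (p : ℝ) : Continuous fun n : BlochSphere => qubitState p n := by
  have h : ∀ a : Fin 3, Continuous fun n : BlochSphere => ((n.1 a : ℝ) : ℂ) := fun a => by fun_prop
  simp only [qubitState_eq]
  have hsum : Continuous fun n : BlochSphere => ∑ a, ((n.1 a : ℝ) : ℂ) • pauli a :=
    continuous_finsetSum _ fun a _ => (h a).smul continuous_const
  exact continuous_const.add (hsum.const_smul (((2 * p - 1 : ℝ) : ℂ) / 2))

/-- The error is continuous on the compact sphere, hence integrable, and ν has total mass 1. -/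
theorem le_averageError (ν : MeasureTheory.Measure BlochSphere) [MeasureTheory.IsProbabilityMeasure ν]
    (E : Matrix (Fin N → Fin 2) (Fin N → Fin 2) ℂ →ₗ[ℂ] Matrix (Fin d) (Fin d) ℂ)
    (D : Matrix (Fin d) (Fin d) ℂ →ₗ[ℂ] Matrix (Fin N → Fin 2) (Fin N → Fin 2) ℂ) {c : ℝ}
    (hc : ∀ n : BlochSphere,
      c ≤ traceNorm (tensorPow N (qubitState p n) - D (E (tensorPow N (qubitState p n)))) / 2) :
    c ≤ averageError p N ν E D := by
  have hρ : Continuous fun n : BlochSphere => tensorPow N (qubitState p n) :=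
    (continuous_tensorPow N).comp (continuous_qubitState p)
  have hDE : Continuous (D ∘ₗ E) := LinearMap.continuous_of_finiteDimensional _
  have hcont : Continuous fun n : BlochSphere =>
      traceNorm (tensorPow N (qubitState p n) - D (E (tensorPow N (qubitState p n)))) / 2 :=
    (continuous_traceNorm.comp (hρ.sub (hDE.comp hρ))).div_const 2
  have hint : MeasureTheory.Integrable (fun n : BlochSphere =>
      traceNorm (tensorPow N (qubitState p n) - D (E (tensorPow N (qubitState p n)))) / 2) ν :=
    hcont.integrable_of_hasCompactSupport (HasCompactSupport.of_compactSpace _)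
  have := MeasureTheory.integral_mono (MeasureTheory.integrable_const c) hint hc
  simpa [averageError] using this

/-- The error bound tends to zero for encodings of dimension at most `N ^ (3 / 2 - δ)`. -/
theorem tendsto_error_bound (hp : 1 / 2 < p) (hp1 : p < 1) {δ : ℝ} (hδ : 0 < δ) :
    Filter.Tendsto (fun N : ℕ => (N : ℝ) ^ (3 / 2 - δ) / (2 * ((2 * p - 1) / 4 * N))
        * (p / (2 * p - 1) * (8 / √(N * p * (1 - p))))
        + N * p * (1 - p) / (N * p - N / 2 - (2 * p - 1) / 4 * N) ^ 2)
      Filter.atTop (nhds 0) := by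
  have hr : 0 < 2 * p - 1 := by linarith
  have hq : 0 < p * (1 - p) := mul_pos (by linarith) (by linarith)
  have h1 : Filter.Tendsto (fun N : ℕ => 16 * p / ((2 * p - 1) ^ 2 * √(p * (1 - p)))
      * (N : ℝ) ^ (-δ) + 16 * (p * (1 - p)) / (2 * p - 1) ^ 2 * ((N : ℝ))⁻¹)
      Filter.atTop (nhds 0) := by
    have h2 := ((tendsto_rpow_neg_atTop hδ).comp tendsto_natCast_atTop_atTop).const_mul
      (16 * p / ((2 * p - 1) ^ 2 * √(p * (1 - p))))
    have h3 := (tendsto_inv_atTop_nhds_zero_nat (𝕜 := ℝ)).const_mul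
      (16 * (p * (1 - p)) / (2 * p - 1) ^ 2)
    simpa using h2.add h3
  refine h1.congr' ?_
  filter_upwards [Filter.eventually_gt_atTop 0] with N hN
  have hN' : (0 : ℝ) < N := by exact_mod_cast hN
  -- One factor N cancels against the sector dimension and √N against the width of the binomial
  -- distribution, which leaves N^(-δ).
  have e1 : (N : ℝ) ^ (3 / 2 - δ) = N * √N * (N : ℝ) ^ (-δ) := by
    rw [Real.sqrt_eq_rpow, ← Real.rpow_one_add' hN'.le (by norm_num), ← Real.rpow_add hN']
    norm_num
    ring_nf
  have e2 : √(N * p * (1 - p)) = √N * √(p * (1 - p)) := by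
    rw [mul_assoc, Real.sqrt_mul hN'.le]
  have hs1 : 0 < √(N : ℝ) := Real.sqrt_pos.2 hN'
  have hs2 : 0 < √(p * (1 - p)) := Real.sqrt_pos.2 hq
  have e3 : (N : ℝ) * p - N / 2 - (2 * p - 1) / 4 * N = (2 * p - 1) / 4 * N := by ring
  rw [e1, e2, e3]
  congr 1
  · field_simp
    ring
  · field_simp
    ring

end ErrorBound

end QubitCompression

theorem theorem3 (p : ℝ) (hp : 1 / 2 < p) (hp1 : p < 1) (δ : ℝ) (hδ : 0 < δ)
    (ε : ℝ) (hε : 0 < ε) :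
    ∃ N₀ : ℕ, ∀ N : ℕ, N₀ ≤ N →
      -- complete ensembles: the distribution of the Bloch vector charges every open set
      ∀ (ν : MeasureTheory.Measure QubitCompression.BlochSphere)
        [MeasureTheory.IsProbabilityMeasure ν] [ν.IsOpenPosMeasure],
      -- encoding systems of at most `(3/2 - δ) log N` qubits, with a representation of `SU(2)`
      ∀ d : ℕ, Real.logb 2 d ≤ (3 / 2 - δ) * Real.logb 2 N →
      ∀ V : QubitCompression.SU2 →* Matrix.unitaryGroup (Fin d) ℂ, Continuous V →
      ∀ (E : Matrix (Fin N → Fin 2) (Fin N → Fin 2) ℂ →ₗ[ℂ] Matrix (Fin d) (Fin d) ℂ)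
        (D : Matrix (Fin d) (Fin d) ℂ →ₗ[ℂ] Matrix (Fin N → Fin 2) (Fin N → Fin 2) ℂ),
        QubitCompression.IsChannel E → QubitCompression.IsChannel D →
        QubitCompression.IsCovariantEncoding V E →
        QubitCompression.PreservesAngMomMagnitude V D →
        1 / 2 - ε ≤ QubitCompression.averageError p N ν E D := by
  obtain ⟨N₁, hN₁⟩ := Filter.eventually_atTop.1
    ((QubitCompression.tendsto_error_bound hp hp1 hδ).eventually_le_const
      (by norm_num : (0 : ℝ) < 1 / 2))
  refine ⟨N₁ + 1, fun N hN ν _ _ d hd V hV E D hE hD _ hDV => ?_⟩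
  have hN0 : 0 < N := by omega
  have hN' : (0 : ℝ) < N := by exact_mod_cast hN0
  have hr : 0 < 2 * p - 1 := by linarith
  have hdN : (d : ℝ) ≤ (N : ℝ) ^ (3 / 2 - δ) := by
    -- For d = 0 the logarithm takes its default value 0, so the bound on d is proved directly.
    rcases Nat.eq_zero_or_pos d with rfl | hd0
    · simpa using Real.rpow_nonneg hN'.le _
    · have hd' : (0 : ℝ) < d := by exact_mod_cast hd0
      rw [← Real.logb_rpow_eq_mul_logb_of_pos hN'] at hd
      exact (Real.logb_le_logb (by norm_num) hd' (Real.rpow_pos_of_pos hN' _)).1 hd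
  -- The cutoff s = (2p - 1)N/4 is half the typical angular momentum (p - 1/2)N: linear in N, yet at
  -- linear distance below the bulk.
  refine QubitCompression.le_averageError ν E D fun n => le_trans ?_
    (QubitCompression.le_error hp hp1 hN0 hV hE hD hDV (s := (2 * p - 1) / 4 * N) (by positivity)
      (by nlinarith) n)
  have hle : (d : ℝ) / (2 * ((2 * p - 1) / 4 * N)) * (p / (2 * p - 1) * (8 / √(N * p * (1 - p))))
      ≤ (N : ℝ) ^ (3 / 2 - δ) / (2 * ((2 * p - 1) / 4 * N))
        * (p / (2 * p - 1) * (8 / √(N * p * (1 - p)))) := by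
    have hp0 : 0 < p := by linarith
    gcongr
  linarith [hN₁ N (by omega)]
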